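/- Let $p,q,n$ be positive integers with $p+q$ odd, and let $a,b\in\{1,-1\}$, with $p\neq 1$ if $b=1$ and $q\neq 1$ if $a=1$. Put $\mathcal H^{(p)}_N(b)=\sum_{m=1}^{N}\frac{b^{m-1}}{m^p}$. For $c=\pm1$, an integer $s\ge 1$ with $(c,s)\ne(1,1)$, and $\alpha>0$, let $\Phi(c,s,\alpha)=\sum_{m=0}^\infty\frac{c^m}{(m+\alpha)^s}$ be the Lerch transcendent, and let $\Phi(1,0,1)=\zeta(0)=-\tfrac12$, $\Phi(-1,0,1)=\eta(0)=\tfrac12$. For $0<s<r$ and integers $k\geq1$ let $\Theta(c,k,s,r)=\Phi(c,k,\tfrac sr)+c(-1)^k\,\Phi(c,k,\tfrac{r-s}{r})$ if $(c,k)\neq(1,1)$, and $\Theta(1,1,s,r)=\pi\cot\left(\tfrac{\pi s}{r}\right)$. Then the series $\sum_{k\ge1}a^k\mathcal H^{(p)}_{nk}(b)/k^q$ converges and \[ \begin{aligned} \sum_{k=1}^\infty\frac{a^k\,\mathcal H_{nk}^{(p)}(b)}{k^q} ={}&\frac12\,ab^{n-1}n^{-p}\,\Phi(ab^n,p+q,1)+\frac12\,a\,(1-(-1)^p)\,\Phi(a,q,1)\,\Phi(b,p,1)\\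 &-ab^n(-n)^q\sum_{k=0}^{\lfloor q/2\rfloor}\binom{p+q-2k-1}{p-1}n^{-2k}\,\Phi(ab^n,2k,1)\,\Phi(b,p+q-2k,1)\\ &+b^{n-1}(-n)^{-p}\sum_{j=0}^{\lfloor p/2\rfloor}\binom{p+q-2j-1}{q-1}\,\Phi(ab^n,2j,1)\,\Phi(a,p+q-2j,1)\\ &+\frac a2\,(-n)^{-p}\sum_{j=2}^{n}\sum_{k=1}^{p}\binom{p+q-k-1}{q-1}b^j(-1)^k\,\Theta(ab^n,k,j-1,n)\,\Phi\!\left(a,p+q-k,\frac{n-j+1}{n}\right). \end{aligned} \] -/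

import Mathlib

open Filter Topology

noncomputable section

/-- The generalized harmonic (`b = 1`) and skew-harmonic (`b = -1`) numbers
`∑_{m=1}^{N} b^(m-1) / m^p`. -/
def genHarmonic (p : ℕ) (b : ℝ) (N : ℕ) : ℝ :=
  ∑ m ∈ Finset.Icc 1 N, b ^ (m - 1) / (m : ℝ) ^ p

open Classical in
/-- The Lerch transcendent `Φ(c, q, α)` for `c = ±1`, a natural number `q` and a real `α`.
For `q ≥ 1` it is the sum of the series `∑_{n ≥ 0} c^n / (n + α)^q`, as the limit of its partial
sums (for `c = -1`, `q = 1` the convergence is only conditional).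
For `q = 0` it is the value at `0` of the analytic continuation in the second variable:
`ζ(0, α) = 1/2 - α` for `c = 1` (so that `Φ(1, 0, 1) = ζ(0) = -1/2`), and `1 / (1 - c)`
for `c ≠ 1` (so that `Φ(-1, 0, 1) = η(0) = 1/2`). -/
def lerchPhi (c : ℝ) (q : ℕ) (α : ℝ) : ℝ :=
  if q = 0 then
    if c = 1 then 1 / 2 - α else 1 / (1 - c)
  else
    limUnder atTop (fun N : ℕ => ∑ n ∈ Finset.range N, c ^ n / ((n : ℝ) + α) ^ q)

open Classical in
/-- `Θ(c, q, s, r) = Φ(c, q, s/r) + c (-1)^q Φ(c, q, (r-s)/r)`; in the case `c = q = 1`, where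
the two series diverge separately, `Θ(1, 1, s, r) = π cot(π s / r)`. -/
def lerchTheta (c : ℝ) (q : ℕ) (s r : ℝ) : ℝ :=
  if c = 1 ∧ q = 1 then Real.pi * Real.cot (Real.pi * s / r)
  else lerchPhi c q (s / r) + c * (-1) ^ q * lerchPhi c q ((r - s) / r)

end

/-! Put c = ab^n. The partial fraction expansion of 1/(z^q (l-z)^p) with respect to l = z + (l-z) is
multiplied by c^k b^l at z = nk, summed over l ≥ 1 and then over -K ≤ k ≤ K, and K tends to
infinity.

On the left, the sum over l is a shifted Lerch series, equal to Φ(b,p,1) plus or minus a harmonic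
number, up to signs and one correction term. Since p+q is odd, the harmonic parts for k = h and k =
-h add up instead of cancelling (`pair_eq_genHarmonic`).

On the right there are two families. Terms in z^(-i) l^(-s) separate, and symmetric summation over k
keeps only even i (`tendsto_sum_product_part`). Terms in l^(-s) (l-nk)^(-i) are split by the residue
r of l mod n. Each residue gives a double series in m and m-k, whose limit is the product of a Lerch
value and a bilateral series, that is Θ for r < n (`tendsto_sum_zpow_mul_tsum`). Convergence may be
only conditional, so this factorisation is the analytic core; it rests on the two
`tendsto_sum_tsum_shift` lemmas.

Two defects remain: the identity fails at k = 0 and at l = z. Their contributions are multiples of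
Φ(b,p+q,1) and Φ(a,p+q,1), which the index-0 terms of the two final sums absorb because Φ(c,0,1) =
-c/2. -/

/-! ### Partial fractions in a commutative ring -/

/-- One half of the partial fraction decomposition of `x⁻ᵠ y⁻ᵖ`, with `X = x⁻¹`,
`Z = (x + y)⁻¹` and `p = P + 1`. -/
theorem partialFraction_half_rec {R : Type*} [CommRing R] (X Z : R) (P q : ℕ) :
    ∑ j ∈ Finset.range (q + 1), ((P + 1 + j).choose j : R) * Z ^ (P + 2 + j) * X ^ (q + 1 - j)
      = Z * (∑ j ∈ Finset.range (q + 1),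
              ((P + j).choose j : R) * Z ^ (P + 1 + j) * X ^ (q + 1 - j)
          + ∑ j ∈ Finset.range q,
              ((P + 1 + j).choose j : R) * Z ^ (P + 2 + j) * X ^ (q - j)) := by
  rw [Finset.sum_range_succ', Finset.sum_range_succ' _ q, mul_add, mul_add, Finset.mul_sum,
    Finset.mul_sum]
  have h : ∀ j ∈ Finset.range q,
      ((P + 1 + (j + 1)).choose (j + 1) : R) * Z ^ (P + 2 + (j + 1)) * X ^ (q + 1 - (j + 1))
      = Z * (((P + (j + 1)).choose (j + 1) : R) * Z ^ (P + 1 + (j + 1)) * X ^ (q + 1 - (j + 1)))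
        + Z * (((P + 1 + j).choose j : R) * Z ^ (P + 2 + j) * X ^ (q - j)) := by
    intro j _
    have h1 : (P + 1 + (j + 1)).choose (j + 1)
        = (P + 1 + j).choose j + (P + (j + 1)).choose (j + 1) := by
      rw [show P + 1 + (j + 1) = (P + 1 + j) + 1 by ring, Nat.choose_succ_succ,
        show P + 1 + j = P + (j + 1) by ring]
    rw [h1, Nat.add_sub_add_right]
    push_cast
    ring
  rw [Finset.sum_congr rfl h, Finset.sum_add_distrib]
  simp
  ring

theorem partialFraction_base {R : Type*} [CommRing R] {X Y Z : R} (h : X * Y = Z * (X + Y))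
    (q : ℕ) :
    X ^ q * Y = ∑ j ∈ Finset.range q, Z ^ (1 + j) * X ^ (q - j) + Z ^ q * Y := by
  induction q with
  | zero => simp
  | succ q ih =>
    rw [Finset.sum_range_succ']
    have h1 : X ^ (q + 1) * Y = Z * X ^ (q + 1) + Z * (X ^ q * Y) := by
      rw [pow_succ, mul_assoc, h]; ring
    have h2 : ∀ j ∈ Finset.range q, Z ^ (1 + (j + 1)) * X ^ (q + 1 - (j + 1))
        = Z * (Z ^ (1 + j) * X ^ (q - j)) := by
      intro j _
      rw [Nat.add_sub_add_right]; ring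
    rw [h1, ih, Finset.sum_congr rfl h2, ← Finset.mul_sum]
    simp
    ring

/-- Trading one factor XY for Z(X+Y) lowers one exponent or the other, so the coefficients obey
Pascal's rule; the cases where an exponent is one start the double induction. -/
theorem partialFraction_aux {R : Type*} [CommRing R] {X Y Z : R} (h : X * Y = Z * (X + Y))
    (Q P : ℕ) :
    X ^ (Q + 1) * Y ^ (P + 1)
      = ∑ j ∈ Finset.range (Q + 1), ((P + j).choose j : R) * Z ^ (P + 1 + j) * X ^ (Q + 1 - j)
      + ∑ j ∈ Finset.range (P + 1), ((Q + j).choose j : R) * Z ^ (Q + 1 + j) * Y ^ (P + 1 - j) := by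
  induction Q generalizing P with
  | zero =>
    have h' : Y * X = Z * (Y + X) := by rw [mul_comm Y, h, add_comm]
    rw [mul_comm, zero_add, pow_one, partialFraction_base h' (P + 1)]
    simp
    ring
  | succ Q ihQ =>
    induction P with
    | zero =>
      rw [zero_add, pow_one, partialFraction_base h (Q + 1 + 1)]
      simp
    | succ P ihP =>
      have h1 : X ^ (Q + 1 + 1) * Y ^ (P + 1 + 1)
          = Z * (X ^ (Q + 1 + 1) * Y ^ (P + 1) + X ^ (Q + 1) * Y ^ (P + 1 + 1)) := by
        calc _ = X ^ (Q + 1) * Y ^ (P + 1) * (X * Y) := by ring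
          _ = _ := by rw [h]; ring
      rw [h1, ihP, ihQ (P + 1)]
      have h2 := partialFraction_half_rec X Z P (Q + 1)
      have h3 := partialFraction_half_rec Y Z Q (P + 1)
      rw [show P + 1 + 1 = P + 2 by ring, show Q + 1 + 1 = Q + 2 by ring] at *
      rw [h2, h3]
      ring

/-- The partial fraction decomposition of `x⁻ᵠ y⁻ᵖ` with respect to `x + y`, written in terms of
the inverses `X`, `Y`, `Z` of `x`, `y`, `x + y`. -/
theorem partialFraction {R : Type*} [CommRing R] {X Y Z : R} (h : X * Y = Z * (X + Y))
    {p q : ℕ} (hp : 1 ≤ p) (hq : 1 ≤ q) :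
    X ^ q * Y ^ p
      = ∑ i ∈ Finset.Icc 1 q, ((p + q - i - 1).choose (p - 1) : R) * Z ^ (p + q - i) * X ^ i
      + ∑ i ∈ Finset.Icc 1 p, ((p + q - i - 1).choose (q - 1) : R) * Z ^ (p + q - i) * Y ^ i := by
  obtain ⟨P, rfl⟩ := Nat.exists_eq_add_of_le' hp
  obtain ⟨Q, rfl⟩ := Nat.exists_eq_add_of_le' hq
  rw [partialFraction_aux h]
  have key : ∀ (A B : ℕ) (W : R),
      ∑ j ∈ Finset.range (B + 1), ((A + j).choose j : R) * Z ^ (A + 1 + j) * W ^ (B + 1 - j)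
      = ∑ i ∈ Finset.Icc 1 (B + 1), ((A + 1 + (B + 1) - i - 1).choose A : R)
          * Z ^ (A + 1 + (B + 1) - i) * W ^ i := by
    intro A B W
    refine Finset.sum_nbij' (fun j => B + 1 - j) (fun i => B + 1 - i) ?_ ?_ ?_ ?_ ?_
    · intro j hj; simp at hj ⊢; omega
    · intro j hj; simp at hj ⊢; omega
    · intro j hj; simp at hj ⊢; omega
    · intro j hj; simp at hj ⊢; omega
    · intro j hj
      simp at hj
      rw [show A + 1 + (B + 1) - (B + 1 - j) = A + 1 + j by omega,
        show A + 1 + j - 1 = A + j by omega, Nat.choose_symm_add]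
  rw [key P Q X, key Q P Y]
  congr 1
  rw [show P + 1 + (Q + 1) = Q + 1 + (P + 1) by ring]
  simp

/-! ### Symmetric sums over the integers and conditionally convergent double series -/

theorem sum_Icc_neg_succ {M : Type*} [AddCommMonoid M] (f : ℤ → M) (K : ℕ) :
    ∑ k ∈ Finset.Icc (-((K + 1 : ℕ) : ℤ)) ((K + 1 : ℕ) : ℤ), f k
      = ∑ k ∈ Finset.Icc (-(K : ℤ)) (K : ℤ), f k + (f (K + 1) + f (-(K + 1))) := by
  rw [Nat.cast_add, Nat.cast_one, Finset.Icc_succ_succ, Finset.sum_union (by simp),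
    Finset.sum_pair (by lia), add_comm (f (-(K + 1)))]

theorem sum_Icc_neg_eq {M : Type*} [AddCommMonoid M] (f : ℤ → M) (K : ℕ) :
    ∑ k ∈ Finset.Icc (-(K : ℤ)) (K : ℤ), f k
      = f 0 + ∑ h ∈ Finset.Icc 1 K, (f h + f (-h)) := by
  induction K with
  | zero => simp
  | succ K ih =>
    rw [sum_Icc_neg_succ, ih, Finset.sum_Icc_succ_top (by omega)]
    push_cast
    rw [add_assoc]

theorem sum_Icc_neg_comp_neg {M : Type*} [AddCommMonoid M] (f : ℤ → M) (K : ℕ) :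
    ∑ k ∈ Finset.Icc (-(K : ℤ)) (K : ℤ), f (-k) = ∑ k ∈ Finset.Icc (-(K : ℤ)) (K : ℤ), f k := by
  rw [sum_Icc_neg_eq, sum_Icc_neg_eq]
  simp [add_comm]

theorem sum_Icc_neg_eq_sub {G : Type*} [AddCommGroup G] (F : ℤ → G) (t : ℤ) (K : ℕ) :
    ∑ k ∈ Finset.Icc (-(K : ℤ)) (K : ℤ), (F (t + k + 1) - F (t + k))
      = F (t + K + 1) - F (t - K) := by
  induction K with
  | zero => simp
  | succ K ih =>
    rw [sum_Icc_neg_succ, ih]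
    push_cast
    rw [show t + (K + 1 : ℤ) = t + K + 1 by ring, show t + -((K : ℤ) + 1) = t - (K + 1) by ring,
      show t - ((K : ℤ) + 1) + 1 = t - K by ring]
    abel

theorem exists_bound_of_tendsto {u : ℕ → ℝ} {x : ℝ} (h : Tendsto u atTop (𝓝 x)) :
    ∃ C, ∀ n, |u n| ≤ C := by
  obtain ⟨C, hC⟩ := h.cauchySeq.norm_bddAbove
  exact ⟨C, fun n => hC ⟨n, rfl⟩⟩

/-- A double series over a strip, summed along the other diagonal: the case where the second
factor is absolutely summable. -/
theorem tendsto_sum_tsum_shift_of_summable {w : ℕ → ℝ} {g : ℤ → ℝ} {W Θ : ℝ}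
    (hw : Tendsto (fun N : ℕ => ∑ m ∈ Finset.range N, w m) atTop (𝓝 W))
    (hg : Summable g)
    (hΘ : Tendsto (fun K : ℕ => ∑ t ∈ Finset.Icc (-(K : ℤ)) (K : ℤ), g t) atTop (𝓝 Θ)) :
    Tendsto (fun K : ℕ => ∑ k ∈ Finset.Icc (-(K : ℤ)) (K : ℤ), ∑' m : ℕ, w m * g (m - k))
      atTop (𝓝 (W * Θ)) := by
  -- F extends the partial sums of w by zero to negative indices. Summing over k then telescopes:
  -- the coefficient of g t is F(t+K+1) - F(t-K), which is bounded and tends to W.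
  set F : ℤ → ℝ := fun z => ∑ m ∈ Finset.range z.toNat, w m with hF
  set v : ℤ → ℝ := fun z => if 0 ≤ z then w z.toNat else 0 with hv
  have hFv : ∀ z, F (z + 1) - F z = v z := by
    intro z
    by_cases hz : 0 ≤ z
    · simp only [hF, hv, if_pos hz]
      rw [show (z + 1).toNat = z.toNat + 1 by omega, Finset.sum_range_succ]
      ring
    · simp only [hF, hv, if_neg hz]
      rw [show (z + 1).toNat = 0 by omega, show z.toNat = 0 by omega]
      simp
  obtain ⟨C, hC⟩ := exists_bound_of_tendsto hw
  have hFC : ∀ z, |F z| ≤ C := fun z => hC _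
  have hvC : ∀ z, |v z| ≤ 2 * C := by
    intro z
    rw [← hFv]
    exact (abs_sub _ _).trans (by linarith [hFC (z + 1), hFC z])
  have htsum : Θ = ∑' t, g t := by
    refine tendsto_nhds_unique hΘ ?_
    exact SummationFilter.hasSum_symmetricIcc_iff.mp
      (hg.hasSum.mono_left (SummationFilter.LeAtTop.le_atTop))
  have hsum : ∀ k : ℤ, Summable (fun t : ℤ => v (t + k) * g t) := by
    intro k
    refine Summable.of_norm_bounded (g := fun t => 2 * C * |g t|) (hg.abs.mul_left _) ?_
    intro t
    rw [Real.norm_eq_abs, abs_mul]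
    exact mul_le_mul_of_nonneg_right (hvC _) (abs_nonneg _)
  have h1 : ∀ k : ℤ, ∑' m : ℕ, w m * g (m - k) = ∑' t : ℤ, v (t + k) * g t := by
    intro k
    rw [← (Equiv.addRight (-k)).tsum_eq (fun t => v (t + k) * g t)]
    have hinj : Function.Injective (fun m : ℕ => (m : ℤ)) := Nat.cast_injective
    rw [← hinj.tsum_eq]
    · refine tsum_congr fun m => ?_
      simp [hv, sub_eq_add_neg]
    · intro z hz
      by_contra hcon
      apply hz
      have : ¬ 0 ≤ z := fun h0 => hcon ⟨z.toNat, by simp [h0]⟩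
      simp [hv, this]
  have h2 : ∀ K : ℕ, ∑ k ∈ Finset.Icc (-(K : ℤ)) (K : ℤ), ∑' m : ℕ, w m * g (m - k)
      = ∑' t : ℤ, (F (t + K + 1) - F (t - K)) * g t := by
    intro K
    simp_rw [h1]
    rw [← Summable.tsum_finsetSum (fun k _ => hsum k)]
    refine tsum_congr fun t => ?_
    rw [← sum_Icc_neg_eq_sub, Finset.sum_mul]
    simp_rw [hFv]
  simp_rw [h2]
  rw [htsum, ← tsum_mul_left]
  refine tendsto_tsum_of_dominated_convergence (bound := fun t => 2 * C * |g t|)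
    (hg.abs.mul_left _) ?_ ?_
  · intro t
    refine Tendsto.mul_const _ ?_
    rw [← sub_zero W]
    refine Tendsto.sub ?_ ?_
    · refine hw.comp (f := fun K : ℕ => (t + K + 1).toNat) ?_
      refine tendsto_atTop.mpr fun b => ?_
      filter_upwards [eventually_ge_atTop (b + (-t).toNat)] with K hK
      omega
    · refine tendsto_const_nhds.congr' ?_
      filter_upwards [eventually_ge_atTop t.toNat] with K hK
      simp only [hF]
      rw [show (t - K).toNat = 0 by omega]
      simp
  · refine Eventually.of_forall fun K t => ?_
    rw [Real.norm_eq_abs, abs_mul]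
    refine mul_le_mul_of_nonneg_right ?_ (abs_nonneg _)
    exact (abs_sub _ _).trans (by linarith [hFC (t + K + 1), hFC (t - K)])

/-- Cauchy–Schwarz. It controls the m boundary terms created by shifting a summation window by m,
and is the source of the weight √m below. -/
theorem abs_sum_le_sqrt_mul_of_injOn {g : ℤ → ℝ} (hg : Summable fun t => g t ^ 2) (m : ℕ)
    {e : ℕ → ℤ} (he : Function.Injective e) :
    |∑ j ∈ Finset.range m, g (e j)| ≤ √m * √(∑' t, g t ^ 2) := by
  rw [← Real.sqrt_mul (Nat.cast_nonneg m)]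
  refine Real.abs_le_sqrt ?_
  refine sq_sum_le_card_mul_sum_sq.trans ?_
  rw [Finset.card_range]
  refine mul_le_mul_of_nonneg_left ?_ (Nat.cast_nonneg m)
  rw [← Finset.sum_image (f := fun t => g t ^ 2) (s := Finset.range m) (g := e)
    (fun x _ y _ h => he h)]
  exact hg.sum_le_tsum _ (fun t _ => sq_nonneg _)

theorem sum_Icc_neg_shift (g : ℤ → ℝ) (K m : ℕ) :
    ∑ k ∈ Finset.Icc (-(K : ℤ)) (K : ℤ), g (m - k)
      = ∑ t ∈ Finset.Icc (-(K : ℤ)) (K : ℤ), g t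
        + (∑ j ∈ Finset.range m, g (j + 1 + K) - ∑ j ∈ Finset.range m, g (j - K)) := by
  rw [← sum_Icc_neg_comp_neg]
  simp only [sub_neg_eq_add]
  induction m with
  | zero => simp
  | succ m ih =>
    rw [Finset.sum_range_succ, Finset.sum_range_succ]
    have h := sum_Icc_neg_eq_sub g m K
    rw [Finset.sum_sub_distrib, ih] at h
    have h' : ∀ k : ℤ, ((m + 1 : ℕ) : ℤ) + k = m + k + 1 := by intro k; push_cast; ring
    simp_rw [h']
    rw [show (m : ℤ) + 1 + K = m + K + 1 by ring]
    linarith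

/-- A double series over a strip, summed along the other diagonal: the case where the first
factor decays fast enough to allow square-summable second factors. -/
theorem tendsto_sum_tsum_shift_of_summable_sq {w : ℕ → ℝ} {g : ℤ → ℝ} {W Θ : ℝ}
    (hw : Summable w) (hw' : Summable fun m : ℕ => |w m| * √m)
    (hW : HasSum w W)
    (hg : Summable fun t => g t ^ 2)
    (hΘ : Tendsto (fun K : ℕ => ∑ t ∈ Finset.Icc (-(K : ℤ)) (K : ℤ), g t) atTop (𝓝 Θ)) :
    Tendsto (fun K : ℕ => ∑ k ∈ Finset.Icc (-(K : ℤ)) (K : ℤ), ∑' m : ℕ, w m * g (m - k))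
      atTop (𝓝 (W * Θ)) := by
  set G := √(∑' t, g t ^ 2) with hG
  obtain ⟨C, hC⟩ := exists_bound_of_tendsto hΘ
  have hgb : ∀ t, |g t| ≤ G := fun t =>
    Real.abs_le_sqrt (hg.le_tsum t (fun _ _ => sq_nonneg _))
  have hg0 : Tendsto g cofinite (𝓝 0) := by
    have := hg.tendsto_cofinite_zero.sqrt
    simp only [Real.sqrt_sq_eq_abs, Real.sqrt_zero] at this
    exact (tendsto_zero_iff_abs_tendsto_zero _).mpr this
  have hsum : ∀ k : ℤ, Summable (fun m : ℕ => w m * g (m - k)) := by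
    intro k
    refine Summable.of_norm_bounded (g := fun m => |w m| * G) (hw.abs.mul_right _) ?_
    intro m
    rw [Real.norm_eq_abs, abs_mul]
    exact mul_le_mul_of_nonneg_left (hgb _) (abs_nonneg _)
  have h2 : ∀ K : ℕ, ∑ k ∈ Finset.Icc (-(K : ℤ)) (K : ℤ), ∑' m : ℕ, w m * g (m - k)
      = ∑' m : ℕ, w m * ∑ k ∈ Finset.Icc (-(K : ℤ)) (K : ℤ), g (m - k) := by
    intro K
    rw [← Summable.tsum_finsetSum (fun k _ => hsum k)]
    simp_rw [Finset.mul_sum]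
  simp_rw [h2]
  rw [← hW.tsum_eq, ← tsum_mul_right]
  -- C bounds the symmetric sums of g, and each of the two boundary sums is at most √m * G. For
  -- fixed m the boundary sums vanish in the limit because g tends to zero.
  refine tendsto_tsum_of_dominated_convergence
    (bound := fun m => |w m| * C + |w m| * √m * (2 * G))
    ((hw.abs.mul_right _).add (hw'.mul_right _)) ?_ ?_
  · intro m
    refine Tendsto.const_mul _ ?_
    simp_rw [sum_Icc_neg_shift]
    rw [← add_zero Θ]
    refine hΘ.add ?_
    rw [← sub_zero (0 : ℝ)]
    have h0 : ∀ e : ℕ → ℕ → ℤ, (∀ j, Function.Injective (e j)) →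
        Tendsto (fun K : ℕ => ∑ j ∈ Finset.range m, g (e j K)) atTop (𝓝 0) := by
      intro e he
      rw [← Finset.sum_const_zero (s := Finset.range m)]
      refine tendsto_finsetSum _ fun j _ => ?_
      rw [← Nat.cofinite_eq_atTop]
      exact hg0.comp (he j).tendsto_cofinite
    refine (h0 (fun j K => (j : ℤ) + 1 + K) ?_).sub (h0 (fun j K => (j : ℤ) - K) ?_)
    · intro j x y h; simpa using h
    · intro j x y h; simpa using h
  · refine Eventually.of_forall fun K m => ?_
    rw [Real.norm_eq_abs, abs_mul, mul_assoc, ← mul_add, sum_Icc_neg_shift]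
    refine mul_le_mul_of_nonneg_left ?_ (abs_nonneg _)
    have h1 := abs_sum_le_sqrt_mul_of_injOn hg m (e := fun j : ℕ => (j : ℤ) + 1 + K)
      (by intro x y h; simpa using h)
    have h3 := abs_sum_le_sqrt_mul_of_injOn hg m (e := fun j : ℕ => (j : ℤ) - K)
      (by intro x y h; simpa using h)
    refine (abs_add_le _ _).trans ?_
    refine add_le_add (hC K) ((abs_sub _ _).trans ?_)
    calc _ ≤ √m * G + √m * G := add_le_add h1 h3
      _ = _ := by ring

/-! ### Signs and one-sided Lerch series -/

theorem abs_zpow_of_sign {c : ℝ} (hc : c = 1 ∨ c = -1) (k : ℤ) : |c ^ k| = 1 := by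
  rcases hc with rfl | rfl <;> simp [abs_zpow]

theorem zpow_neg_of_sign {c : ℝ} (hc : c = 1 ∨ c = -1) (k : ℤ) : c ^ (-k) = c ^ k := by
  rw [zpow_neg, ← inv_zpow]
  rcases hc with rfl | rfl <;> norm_num

theorem ne_zero_of_sign {c : ℝ} (hc : c = 1 ∨ c = -1) : c ≠ 0 := by
  rcases hc with rfl | rfl <;> norm_num

theorem mul_self_of_sign {c : ℝ} (hc : c = 1 ∨ c = -1) : c * c = 1 := by
  rcases hc with rfl | rfl <;> norm_num

theorem sign_mul_pow_sign {a b : ℝ} (ha : a = 1 ∨ a = -1) (hb : b = 1 ∨ b = -1) (n : ℕ) :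
    a * b ^ n = 1 ∨ a * b ^ n = -1 := by
  rcases ha with rfl | rfl <;> rcases hb with rfl | rfl <;>
    rcases neg_one_pow_eq_or ℝ n with h | h <;> simp [h]

theorem summable_int_inv_add_pow (α : ℝ) {s : ℕ} (hs : 2 ≤ s) :
    Summable fun t : ℤ => |((t : ℝ) + α)⁻¹ ^ s| := by
  have := (Real.summable_one_div_int_add_rpow α s).mpr (by exact_mod_cast hs)
  refine this.congr fun t => ?_
  rw [Real.rpow_natCast, abs_pow, abs_inv, one_div, inv_pow]

theorem summable_nat_inv_add_pow (α : ℝ) {s : ℕ} (hs : 2 ≤ s) :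
    Summable fun m : ℕ => |((m : ℝ) + α)⁻¹ ^ s| := by
  have := (Real.summable_one_div_nat_add_rpow α s).mpr (by exact_mod_cast hs)
  refine this.congr fun t => ?_
  rw [Real.rpow_natCast, abs_pow, abs_inv, one_div, inv_pow]

theorem summable_lerch {c : ℝ} (hc : c = 1 ∨ c = -1) {s : ℕ} (hs : 2 ≤ s) (α : ℝ) :
    Summable fun m : ℕ => c ^ m * ((m : ℝ) + α)⁻¹ ^ s := by
  refine Summable.of_norm ?_
  refine (summable_nat_inv_add_pow α hs).congr fun m => ?_
  rw [Real.norm_eq_abs, abs_mul, ← zpow_natCast c, abs_zpow_of_sign hc, one_mul]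

theorem tendsto_lerchPhi {c : ℝ} (hc : c = 1 ∨ c = -1) {s : ℕ} (hs : 1 ≤ s)
    (hcs : c = 1 → s ≠ 1) {α : ℝ} (hα : 0 < α) :
    Tendsto (fun N : ℕ => ∑ m ∈ Finset.range N, c ^ m * ((m : ℝ) + α)⁻¹ ^ s) atTop
      (𝓝 (lerchPhi c s α)) := by
  have key : ∃ x, Tendsto (fun N : ℕ => ∑ m ∈ Finset.range N, c ^ m * ((m : ℝ) + α)⁻¹ ^ s) atTop
      (𝓝 x) := by
    by_cases h2 : 2 ≤ s
    · exact ⟨_, (summable_lerch hc h2 α).hasSum.tendsto_sum_nat⟩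
    · have h1 : s = 1 := by omega
      have hc' : c = -1 := by
        rcases hc with h | h
        · exact absurd h1 (hcs h)
        · exact h
      subst h1 hc'
      refine Antitone.tendsto_alternating_series_of_tendsto_zero ?_ ?_
      · intro x y hxy
        have : (x : ℝ) ≤ y := by exact_mod_cast hxy
        simp only [pow_one]
        gcongr
      · simp only [pow_one]
        exact tendsto_inv_atTop_zero.comp
          (tendsto_atTop_add_const_right _ _ tendsto_natCast_atTop_atTop)
  have h : lerchPhi c s α
      = limUnder atTop (fun N : ℕ => ∑ m ∈ Finset.range N, c ^ m * ((m : ℝ) + α)⁻¹ ^ s) := by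
    rw [lerchPhi, if_neg (by omega)]
    simp_rw [inv_pow, div_eq_mul_inv]
  rw [h]
  exact tendsto_nhds_limUnder key

/-- A single formula for ζ(0) and η(0), so that the index-0 terms can be handled without cases on
the sign. -/
theorem lerchPhi_zero_one {c : ℝ} (hc : c = 1 ∨ c = -1) : lerchPhi c 0 1 = -c / 2 := by
  rcases hc with rfl | rfl
  · norm_num [lerchPhi]
  · rw [lerchPhi]; norm_num

theorem hasSum_lerchPhi {c : ℝ} (hc : c = 1 ∨ c = -1) {s : ℕ} (hs : 2 ≤ s) {α : ℝ} (hα : 0 < α) :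
    HasSum (fun m : ℕ => c ^ m * ((m : ℝ) + α)⁻¹ ^ s) (lerchPhi c s α) := by
  have h := (summable_lerch hc hs α).hasSum
  rwa [tendsto_nhds_unique (tendsto_lerchPhi hc (by omega) (by omega) hα)
    h.tendsto_sum_nat]

theorem sum_Icc_one_eq_sum_range {M : Type*} [AddCommMonoid M] (f : ℕ → M) (N : ℕ) :
    ∑ h ∈ Finset.Icc 1 N, f h = ∑ m ∈ Finset.range N, f (m + 1) := by
  induction N with
  | zero => simp
  | succ N ih => rw [Finset.sum_Icc_succ_top (by omega), ih, Finset.sum_range_succ]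

theorem tendsto_sum_Icc_one {c : ℝ} (hc : c = 1 ∨ c = -1) {s : ℕ} (hs : 1 ≤ s)
    (hcs : c = 1 → s ≠ 1) :
    Tendsto (fun N : ℕ => ∑ h ∈ Finset.Icc 1 N, c ^ h * ((h : ℝ))⁻¹ ^ s) atTop
      (𝓝 (c * lerchPhi c s 1)) := by
  refine ((tendsto_lerchPhi hc hs hcs one_pos).const_mul c).congr fun N => ?_
  rw [sum_Icc_one_eq_sum_range, Finset.mul_sum]
  refine Finset.sum_congr rfl fun m _ => ?_
  push_cast
  ring

/-! ### Bilateral Lerch series -/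

/-- The symmetric sum `∑ c^k / k^i` over nonzero integers. -/
theorem tendsto_sum_punctured {c : ℝ} (hc : c = 1 ∨ c = -1) {i : ℕ} (hi : 1 ≤ i) :
    Tendsto (fun K : ℕ => ∑ k ∈ Finset.Icc (-(K : ℤ)) (K : ℤ), c ^ k * ((k : ℝ))⁻¹ ^ i) atTop
      (𝓝 (if Even i then 2 * c * lerchPhi c i 1 else 0)) := by
  -- The term k = 0 vanishes since `0⁻¹ = 0`, and k = ±h differ by the factor (-1)^i.
  have h0 : ∀ K : ℕ, ∑ k ∈ Finset.Icc (-(K : ℤ)) (K : ℤ), c ^ k * ((k : ℝ))⁻¹ ^ i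
      = (1 + (-1) ^ i) * ∑ h ∈ Finset.Icc 1 K, c ^ h * ((h : ℝ))⁻¹ ^ i := by
    intro K
    rw [sum_Icc_neg_eq, Finset.mul_sum]
    simp only [Int.cast_zero, inv_zero, zero_pow (show i ≠ 0 by omega), mul_zero, zero_add]
    refine Finset.sum_congr rfl fun h _ => ?_
    rw [zpow_neg_of_sign hc]
    push_cast
    rw [inv_neg, neg_pow, zpow_natCast]
    ring
  simp_rw [h0]
  by_cases he : Even i
  · rw [if_pos he, he.neg_one_pow]
    convert (tendsto_sum_Icc_one hc hi ?_).const_mul (1 + 1 : ℝ) using 2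
    · ring
    · rintro - rfl; exact absurd he (by decide)
  · rw [if_neg he, (Nat.not_even_iff_odd.mp he).neg_one_pow]
    simp

theorem tendsto_lerch_term {c : ℝ} (hc : c = 1 ∨ c = -1) {i : ℕ} (hi : 1 ≤ i) (α : ℝ) :
    Tendsto (fun K : ℕ => c ^ K * ((K : ℝ) + α)⁻¹ ^ i) atTop (𝓝 0) := by
  have h : Tendsto (fun K : ℕ => ((K : ℝ) + α)⁻¹ ^ i) atTop (𝓝 0) := by
    have := (tendsto_inv_atTop_zero.comp
          (tendsto_atTop_add_const_right atTop α (tendsto_natCast_atTop_atTop (R := ℝ)))).pow i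
    rwa [zero_pow (by omega)] at this
  refine bdd_le_mul_tendsto_zero' 1 (Eventually.of_forall fun K => ?_) h
  rw [← zpow_natCast, abs_zpow_of_sign hc]

/-- The symmetric sum `∑ c^t / (t + 1)^i` over integers `t ≠ -1`. -/
theorem tendsto_sum_punctured_shift {c : ℝ} (hc : c = 1 ∨ c = -1) {i : ℕ} (hi : 1 ≤ i) :
    Tendsto (fun K : ℕ => ∑ t ∈ Finset.Icc (-(K : ℤ)) (K : ℤ), c ^ t * ((t : ℝ) + 1)⁻¹ ^ i) atTop
      (𝓝 (if Even i then 2 * lerchPhi c i 1 else 0)) := by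
  set F : ℤ → ℝ := fun k => c ^ k * ((k : ℝ))⁻¹ ^ i with hF
  -- Reindexing by k = t + 1 costs a factor c and two boundary terms, which tend to zero.
  have h0 : ∀ K : ℕ, ∑ t ∈ Finset.Icc (-(K : ℤ)) (K : ℤ), c ^ t * ((t : ℝ) + 1)⁻¹ ^ i
      = c * (∑ k ∈ Finset.Icc (-(K : ℤ)) (K : ℤ), F k + (F (K + 1) - F (-K))) := by
    intro K
    have h1 := sum_Icc_neg_eq_sub F 0 K
    simp only [zero_add, zero_sub] at h1
    rw [← h1, ← Finset.sum_add_distrib, Finset.mul_sum]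
    refine Finset.sum_congr rfl fun t _ => ?_
    rw [add_sub_cancel]
    simp only [hF]
    rw [zpow_add_one₀ (ne_zero_of_sign hc)]
    push_cast
    linear_combination (-(c ^ t * ((t : ℝ) + 1)⁻¹ ^ i)) * mul_self_of_sign hc
  simp_rw [h0]
  have h1 : Tendsto (fun K : ℕ => F (K + 1)) atTop (𝓝 0) := by
    have h := (tendsto_lerch_term hc hi 1).const_mul c
    rw [mul_zero] at h
    refine h.congr fun K => ?_
    simp only [hF]
    rw [zpow_add_one₀ (ne_zero_of_sign hc), zpow_natCast]
    push_cast
    ring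
  have h2 : Tendsto (fun K : ℕ => F (-K)) atTop (𝓝 0) := by
    have h := (tendsto_lerch_term hc hi 0).const_mul ((-1 : ℝ) ^ i)
    rw [mul_zero] at h
    refine h.congr fun K => ?_
    simp only [hF]
    rw [zpow_neg_of_sign hc, zpow_natCast]
    push_cast
    rw [add_zero, inv_neg, neg_pow ((K : ℝ)⁻¹)]
    ring
  have h3 := ((tendsto_sum_punctured hc hi).add (h1.sub h2)).const_mul c
  convert h3 using 2
  split_ifs
  · linear_combination (-(2 * lerchPhi c i 1)) * mul_self_of_sign hc
  · ring

theorem tendsto_cot_series {x : ℝ} (h0 : 0 < x) (h1 : x < 1) :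
    Tendsto (fun K : ℕ => ∑ t ∈ Finset.Icc (-(K : ℤ)) (K : ℤ), ((t : ℝ) + x)⁻¹) atTop
      (𝓝 (Real.pi * Real.cot (Real.pi * x))) := by
  have hx : (x : ℂ) ∈ Complex.integerComplement := by
    rw [Complex.mem_integerComplement_iff]
    rintro ⟨n, hn⟩
    have hn' : (n : ℝ) = x := by exact_mod_cast hn
    rw [← hn'] at h0 h1
    have h0' : 0 < n := by exact_mod_cast h0
    have h1' : n < 1 := by exact_mod_cast h1
    omega
  -- The Mittag-Leffler expansion gives π cot(πx) - 1/x; the restored 1/x is the term t = 0.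
  have h := (tendsto_logDeriv_euler_cot_sub hx).const_add (1 / (x : ℂ))
  rw [add_sub_cancel] at h
  rw [← Filter.tendsto_ofReal_iff]
  convert h using 1
  · funext K
    simp only [cotTerm]
    rw [sum_Icc_neg_eq, sum_Icc_one_eq_sum_range]
    push_cast
    rw [zero_add, one_div]
    congr 1
    refine Finset.sum_congr rfl fun j _ => ?_
    rw [one_div, one_div, add_comm]
    congr 2 <;> ring
  · push_cast
    rfl

/-- The bilateral series `∑ c^t / (t + s / r)^i`, summed symmetrically. -/
theorem tendsto_lerchTheta {c : ℝ} (hc : c = 1 ∨ c = -1) {i : ℕ} (hi : 1 ≤ i) {s r : ℝ}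
    (hs : 0 < s) (hsr : s < r) :
    Tendsto (fun K : ℕ => ∑ t ∈ Finset.Icc (-(K : ℤ)) (K : ℤ), c ^ t * ((t : ℝ) + s / r)⁻¹ ^ i)
      atTop (𝓝 (lerchTheta c i s r)) := by
  have hr : 0 < r := hs.trans hsr
  have hx0 : 0 < s / r := div_pos hs hr
  have hx1 : s / r < 1 := (div_lt_one hr).mpr hsr
  rw [lerchTheta]
  split_ifs with h
  · obtain ⟨rfl, rfl⟩ := h
    simp only [one_zpow, pow_one, one_mul]
    rw [mul_div_assoc]
    exact tendsto_cot_series hx0 hx1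
  · have hci : c = 1 → i ≠ 1 := fun h1 h2 => h ⟨h1, h2⟩
    have hsr' : (r - s) / r = 1 - s / r := by field_simp
    -- The indices 0 ≤ t ≤ K give K + 1 terms, hence the shift. Those with t = -(m+1) have t + s/r =
    -- -(m + (r-s)/r), which produces the factor c (-1)^i.
    have hA := (tendsto_lerchPhi hc hi hci hx0).comp (tendsto_add_atTop_nat 1)
    have hB := (tendsto_lerchPhi hc hi hci (α := (r - s) / r)
      (div_pos (by linarith) hr)).const_mul (c * (-1) ^ i)
    refine (hA.add hB).congr fun K => ?_
    rw [sum_Icc_neg_eq, sum_Icc_one_eq_sum_range, Function.comp, Finset.sum_range_succ',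
      Finset.sum_add_distrib, Finset.mul_sum, hsr']
    have e1 : ∀ m : ℕ, c * (-1) ^ i * (c ^ m * ((m : ℝ) + (1 - s / r))⁻¹ ^ i)
        = c ^ (-((m + 1 : ℕ) : ℤ)) * (((-((m + 1 : ℕ) : ℤ) : ℤ) : ℝ) + s / r)⁻¹ ^ i := by
      intro m
      rw [zpow_neg_of_sign hc, zpow_natCast]
      push_cast
      rw [show -((m : ℝ) + 1) + s / r = -((m : ℝ) + (1 - s / r)) by ring, inv_neg,
        neg_pow ((m : ℝ) + (1 - s / r))⁻¹]
      ring
    simp_rw [e1]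
    simp only [Int.cast_natCast, zpow_natCast, Nat.cast_zero, Int.cast_zero, pow_zero, zpow_zero]
    ring

/-- Needed to pass from the residue r to the index j = n + 1 - r of the final formula. -/
theorem lerchTheta_reflect {c : ℝ} (hc : c = 1 ∨ c = -1) (i : ℕ) {s r : ℝ} (hr : r ≠ 0) :
    lerchTheta c i (r - s) r = c * (-1) ^ i * lerchTheta c i s r := by
  rw [lerchTheta, lerchTheta]
  split_ifs with h
  · obtain ⟨rfl, rfl⟩ := h
    rw [mul_sub, sub_div, mul_div_cancel_right₀ _ hr, Real.cot_eq_cos_div_sin,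
      Real.cot_eq_cos_div_sin, Real.cos_pi_sub, Real.sin_pi_sub]
    ring
  · rw [sub_sub_cancel]
    have h1 : ((-1 : ℝ) ^ i) * (-1) ^ i = 1 := by rw [← mul_pow]; simp
    linear_combination (-(lerchPhi c i ((r - s) / r)) * (c * c)) * h1
      - (lerchPhi c i ((r - s) / r)) * mul_self_of_sign hc

/-! ### Factorisation of the double Lerch series -/

theorem summable_inv_add_pow_mul_sqrt {α : ℝ} (hα : 0 < α) {s : ℕ} (hs : 2 ≤ s) :
    Summable fun m : ℕ => ((m : ℝ) + α)⁻¹ ^ s * √m := by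
  have h : Summable fun m : ℕ => (m : ℝ) ^ (-(3 / 2) : ℝ) :=
    Real.summable_nat_rpow.mpr (by norm_num)
  refine Summable.of_nonneg_of_le (fun m => by positivity) (fun m => ?_) h
  rcases Nat.eq_zero_or_pos m with rfl | hm
  · simp only [Nat.cast_zero, Real.sqrt_zero, mul_zero]
    positivity
  · have hm1 : (1 : ℝ) ≤ m := by exact_mod_cast hm
    have hm0 : (0 : ℝ) < m := by linarith
    calc ((m : ℝ) + α)⁻¹ ^ s * √m ≤ (m : ℝ)⁻¹ ^ 2 * √m := by
          refine mul_le_mul_of_nonneg_right ?_ (Real.sqrt_nonneg _)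
          calc ((m : ℝ) + α)⁻¹ ^ s ≤ (m : ℝ)⁻¹ ^ s := by gcongr; linarith
            _ ≤ (m : ℝ)⁻¹ ^ 2 := pow_le_pow_of_le_one (by positivity) (inv_le_one_of_one_le₀ hm1) hs
      _ = (m : ℝ) ^ (-(3 / 2) : ℝ) := by
          rw [Real.sqrt_eq_rpow, inv_pow, ← Real.rpow_natCast, ← Real.rpow_neg hm0.le,
            ← Real.rpow_add hm0]
          norm_num

/-- The double Lerch series over a strip around the diagonal factors in the limit. -/
theorem tendsto_sum_tsum_lerch {a c : ℝ} (ha : a = 1 ∨ a = -1) (hc : c = 1 ∨ c = -1) {s i : ℕ}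
    (hs : 1 ≤ s) (hi : 1 ≤ i) (hsi : s = 1 → a = -1 ∧ 2 ≤ i) {α Θ : ℝ} (hα : 0 < α)
    (hΘ : Tendsto (fun K : ℕ => ∑ t ∈ Finset.Icc (-(K : ℤ)) (K : ℤ), c ^ t * ((t : ℝ) + α)⁻¹ ^ i)
      atTop (𝓝 Θ)) :
    Tendsto (fun K : ℕ => ∑ k ∈ Finset.Icc (-(K : ℤ)) (K : ℤ), ∑' m : ℕ,
        (a ^ m * ((m : ℝ) + α)⁻¹ ^ s) * (c ^ ((m : ℤ) - k) * ((m : ℝ) - k + α)⁻¹ ^ i))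
      atTop (𝓝 (lerchPhi a s α * Θ)) := by
  set g : ℤ → ℝ := fun t => c ^ t * ((t : ℝ) + α)⁻¹ ^ i with hg
  have hgk : ∀ (m : ℕ) (k : ℤ),
      c ^ ((m : ℤ) - k) * ((m : ℝ) - k + α)⁻¹ ^ i = g (m - k) := by
    intro m k
    simp only [hg]
    push_cast
    rfl
  simp_rw [hgk]
  -- For s = 1 the first factor converges only conditionally, but i ≥ 2 makes the bilateral one
  -- absolutely summable. For s ≥ 2 the exponent i may be 1, where the bilateral factor is only
  -- square-summable.
  by_cases h1 : s = 1
  · obtain ⟨ha1, hi2⟩ := hsi h1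
    refine tendsto_sum_tsum_shift_of_summable
      (tendsto_lerchPhi ha hs (fun h => by rw [ha1] at h; norm_num at h) hα) ?_ hΘ
    refine Summable.of_norm ((summable_int_inv_add_pow α hi2).congr fun t => ?_)
    rw [Real.norm_eq_abs, abs_mul, abs_zpow_of_sign hc, one_mul]
  · have hs2 : 2 ≤ s := by omega
    refine tendsto_sum_tsum_shift_of_summable_sq (summable_lerch ha hs2 α) ?_
      (hasSum_lerchPhi ha hs2 hα) ?_ hΘ
    · refine (summable_inv_add_pow_mul_sqrt hα hs2).congr fun m => ?_
      rw [abs_mul, ← zpow_natCast a, abs_zpow_of_sign ha, one_mul, abs_of_nonneg (by positivity)]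
    · refine (summable_int_inv_add_pow α (s := 2 * i) (by omega)).congr fun t => ?_
      rw [abs_of_nonneg (by rw [pow_mul]; positivity), mul_pow, ← sq_abs (c ^ t),
        abs_zpow_of_sign hc]
      ring

theorem abs_inv_intCast_le_one (z : ℤ) : |((z : ℝ))⁻¹| ≤ 1 := by
  rcases eq_or_ne z 0 with rfl | hz
  · simp
  · rw [abs_inv]
    refine inv_le_one_of_one_le₀ ?_
    exact_mod_cast Int.one_le_abs hz

/-- Inverses of integers have absolute value at most 1 (also `0⁻¹ = 0`), so both exponents may be
lowered to one; then uv ≤ u² + v². -/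
theorem summable_inv_pow_mul_inv_sub_pow {b : ℝ} (hb : b = 1 ∨ b = -1) {s i : ℕ} (hs : 1 ≤ s)
    (hi : 1 ≤ i) (z : ℤ) :
    Summable fun m : ℕ => b ^ (m + 1) * ((m : ℝ) + 1)⁻¹ ^ s * ((m : ℝ) + 1 - z)⁻¹ ^ i := by
  have h1 := summable_nat_inv_add_pow 1 le_rfl
  have h2 := summable_nat_inv_add_pow (1 - z) le_rfl
  refine Summable.of_norm_bounded (h1.add h2) fun m => ?_
  have e : (m : ℝ) + 1 - z = ((m + 1 - z : ℤ) : ℝ) := by push_cast; ring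
  have hu : |((m : ℝ) + 1)⁻¹| ≤ 1 := by
    have := abs_inv_intCast_le_one (m + 1)
    push_cast at this
    exact this
  have hv : |((m : ℝ) + 1 - z)⁻¹| ≤ 1 := by rw [e]; exact abs_inv_intCast_le_one _
  rw [Real.norm_eq_abs, abs_mul, abs_mul, ← zpow_natCast b, abs_zpow_of_sign hb, one_mul,
    abs_pow, abs_pow, ← add_sub_assoc, abs_pow, abs_pow]
  have hu' := pow_le_of_le_one (abs_nonneg _) hu (show s ≠ 0 by omega)
  have hv' := pow_le_of_le_one (abs_nonneg _) hv (show i ≠ 0 by omega)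
  calc _ ≤ |((m : ℝ) + 1)⁻¹| * |((m : ℝ) + 1 - z)⁻¹| :=
        mul_le_mul hu' hv' (by positivity) (abs_nonneg _)
    _ ≤ _ := by nlinarith [sq_nonneg (|((m : ℝ) + 1)⁻¹| - |((m : ℝ) + 1 - z)⁻¹|),
        sq_nonneg |((m : ℝ) + 1)⁻¹|, sq_nonneg |((m : ℝ) + 1 - z)⁻¹|]

/-! ### Splitting by residues modulo n -/

theorem tsum_eq_sum_residues {f : ℕ → ℝ} (hf : Summable f) {n : ℕ} (hn : 1 ≤ n) :
    ∑' l, f l = ∑ r ∈ Finset.range n, ∑' m, f (m * n + r) := by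
  have : NeZero n := ⟨by omega⟩
  have h := ((Equiv.prodComm (Fin n) ℕ).trans (Nat.divModEquiv n).symm).tsum_eq f
  have hs := ((Equiv.prodComm (Fin n) ℕ).trans (Nat.divModEquiv n).symm).summable_iff.mpr hf
  rw [← h, Summable.tsum_prod (f := fun p => f (((Equiv.prodComm (Fin n) ℕ).trans
    (Nat.divModEquiv n).symm) p)) hs, tsum_fintype,
    ← Fin.sum_univ_eq_sum_range (fun r => ∑' m, f (m * n + r))]
  simp

/-- With l = nm + r and 1 ≤ r ≤ n, l - nk = n((m-k) + r/n), and with c = ab^n, c^k b^l = b^r a^m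
c^(m-k) because a² = 1. This separates m from m - k. -/
theorem zpow_mul_tsum_eq_sum_residues {a b : ℝ} (ha : a = 1 ∨ a = -1) (hb : b = 1 ∨ b = -1)
    {n : ℕ} (hn : 1 ≤ n) {s i : ℕ} (hs : 1 ≤ s) (hi : 1 ≤ i) (k : ℤ) :
    (a * b ^ n) ^ k * ∑' m : ℕ, b ^ (m + 1) * ((m : ℝ) + 1)⁻¹ ^ s * ((m : ℝ) + 1 - n * k)⁻¹ ^ i
      = ∑ r ∈ Finset.Icc 1 n, b ^ r * (n : ℝ)⁻¹ ^ (s + i) * ∑' m : ℕ,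
        (a ^ m * ((m : ℝ) + (r : ℝ) / n)⁻¹ ^ s) *
          ((a * b ^ n) ^ ((m : ℤ) - k) * ((m : ℝ) - k + (r : ℝ) / n)⁻¹ ^ i) := by
  have hc := sign_mul_pow_sign ha hb n
  have hn0 : (n : ℝ) ≠ 0 := by positivity
  have hsum := summable_inv_pow_mul_inv_sub_pow hb hs hi (n * k)
  push_cast at hsum
  rw [tsum_eq_sum_residues hsum hn, sum_Icc_one_eq_sum_range, Finset.mul_sum]
  refine Finset.sum_congr rfl fun r _ => ?_
  rw [← tsum_mul_left, ← tsum_mul_left]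
  refine tsum_congr fun m => ?_
  have e1 : (((m * n + r : ℕ) : ℝ) + 1)⁻¹ = (n : ℝ)⁻¹ * ((m : ℝ) + ((r + 1 : ℕ) : ℝ) / n)⁻¹ := by
    rw [← mul_inv]; congr 1; push_cast; field_simp; ring
  have e2 : (((m * n + r : ℕ) : ℝ) + 1 - n * k)⁻¹
      = (n : ℝ)⁻¹ * ((m : ℝ) - k + ((r + 1 : ℕ) : ℝ) / n)⁻¹ := by
    rw [← mul_inv]; congr 1; push_cast; field_simp; ring
  rw [e1, e2, mul_pow, mul_pow, sub_eq_add_neg (m : ℤ), zpow_add₀ (ne_zero_of_sign hc),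
    zpow_neg_of_sign hc, zpow_natCast, mul_pow a, pow_add (n : ℝ)⁻¹,
    show m * n + r + 1 = n * m + (r + 1) by ring, pow_add b, pow_mul b]
  have h1 : a ^ m * a ^ m = 1 := by rw [← mul_pow, mul_self_of_sign ha, one_pow]
  linear_combination (-((a * b ^ n) ^ k * (b ^ n) ^ m * b ^ (r + 1) * (n : ℝ)⁻¹ ^ s
    * (n : ℝ)⁻¹ ^ i * ((m : ℝ) + ((r + 1 : ℕ) : ℝ) / n)⁻¹ ^ s *
    ((m : ℝ) - k + ((r + 1 : ℕ) : ℝ) / n)⁻¹ ^ i)) * h1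

/-- The limit of the symmetric partial sums over `k` of
`∑_{l ≥ 1} c^k b^l / (l^s (l - nk)^i)`, where `c = a b^n`. -/
theorem tendsto_sum_zpow_mul_tsum {a b : ℝ} (ha : a = 1 ∨ a = -1) (hb : b = 1 ∨ b = -1)
    {n : ℕ} (hn : 1 ≤ n) {s i : ℕ} (hs : 1 ≤ s) (hi : 1 ≤ i) (hsi : s = 1 → a = -1 ∧ 2 ≤ i) :
    Tendsto (fun K : ℕ => ∑ k ∈ Finset.Icc (-(K : ℤ)) (K : ℤ), (a * b ^ n) ^ k *
        ∑' m : ℕ, b ^ (m + 1) * ((m : ℝ) + 1)⁻¹ ^ s * ((m : ℝ) + 1 - n * k)⁻¹ ^ i) atTop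
      (𝓝 ((n : ℝ)⁻¹ ^ (s + i) * (∑ r ∈ Finset.Ico 1 n,
          b ^ r * (lerchPhi a s ((r : ℝ) / n) * lerchTheta (a * b ^ n) i r n)
        + b ^ n * (lerchPhi a s 1 * if Even i then 2 * lerchPhi (a * b ^ n) i 1 else 0)))) := by
  have hc := sign_mul_pow_sign ha hb n
  have hn0 : (0 : ℝ) < n := by positivity
  simp_rw [zpow_mul_tsum_eq_sum_residues ha hb hn hs hi]
  -- The residue r = n stands apart: l - nk can vanish there, so the punctured bilateral series
  -- replaces Θ.
  have hIcc : ∀ f : ℕ → ℝ, ∑ r ∈ Finset.Icc 1 n, f r = ∑ r ∈ Finset.Ico 1 n, f r + f n := by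
    intro f
    rw [← Finset.sum_Ico_succ_top hn]
    rfl
  simp_rw [hIcc, Finset.sum_add_distrib]
  rw [mul_add, Finset.mul_sum]
  apply Filter.Tendsto.add
  · simp_rw [Finset.sum_comm (t := Finset.Ico 1 n)]
    refine tendsto_finsetSum _ fun r hr => ?_
    simp_rw [← Finset.mul_sum]
    rw [Finset.mem_Ico] at hr
    have hr0 : (0 : ℝ) < r := by exact_mod_cast hr.1
    have hrn : (r : ℝ) < n := by exact_mod_cast hr.2
    have h := (tendsto_sum_tsum_lerch ha hc hs hi hsi (div_pos hr0 hn0)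
      (tendsto_lerchTheta hc hi hr0 hrn)).const_mul (b ^ r * (n : ℝ)⁻¹ ^ (s + i))
    convert h using 2
    ring
  · simp_rw [← Finset.mul_sum, div_self hn0.ne']
    have h := (tendsto_sum_tsum_lerch ha hc hs hi hsi one_pos
      (tendsto_sum_punctured_shift hc hi)).const_mul (b ^ n * (n : ℝ)⁻¹ ^ (s + i))
    convert h using 2
    ring

/-! ### Shifted series and harmonic numbers -/

theorem genHarmonic_succ (p : ℕ) (b : ℝ) (N : ℕ) :
    genHarmonic p b (N + 1) = genHarmonic p b N + b ^ N * ((N : ℝ) + 1)⁻¹ ^ p := by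
  rw [genHarmonic, genHarmonic, Finset.sum_Icc_succ_top (by omega), Nat.add_sub_cancel,
    inv_pow, div_eq_mul_inv (b ^ N)]
  push_cast
  rfl

theorem sum_range_eq_mul_genHarmonic (p : ℕ) (b : ℝ) (N : ℕ) :
    ∑ m ∈ Finset.range N, b ^ (m + 1) * ((m : ℝ) + 1)⁻¹ ^ p = b * genHarmonic p b N := by
  induction N with
  | zero => simp [genHarmonic]
  | succ N ih => rw [Finset.sum_range_succ, ih, genHarmonic_succ]; ring

theorem tendsto_sum_range_lerchPhi_one {b : ℝ} (hb : b = 1 ∨ b = -1) {p : ℕ} (hp : 1 ≤ p)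
    (hpb : b = 1 → p ≠ 1) :
    Tendsto (fun L : ℕ => ∑ m ∈ Finset.range L, b ^ (m + 1) * ((m : ℝ) + 1)⁻¹ ^ p) atTop
      (𝓝 (b * lerchPhi b p 1)) := by
  refine ((tendsto_lerchPhi hb hp hpb one_pos).const_mul b).congr fun L => ?_
  rw [Finset.mul_sum]
  exact Finset.sum_congr rfl fun m _ => by ring

theorem pow_mul_pow_self_of_sign {b : ℝ} (hb : b = 1 ∨ b = -1) (n : ℕ) : b ^ n * b ^ n = 1 := by
  rw [← mul_pow, mul_self_of_sign hb, one_pow]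

theorem tendsto_sum_shift_add {b : ℝ} (hb : b = 1 ∨ b = -1) {p : ℕ} (hp : 1 ≤ p)
    (hpb : b = 1 → p ≠ 1) (N : ℕ) :
    Tendsto (fun L : ℕ => ∑ m ∈ Finset.range L, b ^ (m + 1) * ((m : ℝ) + 1 + N)⁻¹ ^ p) atTop
      (𝓝 (b ^ N * b * (lerchPhi b p 1 - genHarmonic p b N))) := by
  have h := (((tendsto_sum_range_lerchPhi_one hb hp hpb).comp
    (tendsto_add_atTop_nat N)).sub_const (b * genHarmonic p b N)).const_mul (b ^ N)
  convert h using 2 with L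
  · rw [Function.comp, add_comm L N, Finset.sum_range_add, sum_range_eq_mul_genHarmonic,
      add_sub_cancel_left, Finset.mul_sum]
    refine Finset.sum_congr rfl fun m _ => ?_
    push_cast
    rw [show (m : ℝ) + 1 + N = N + m + 1 by ring, show N + m + 1 = N + (m + 1) by ring, pow_add b]
    linear_combination (-(b ^ (m + 1) * ((N : ℝ) + m + 1)⁻¹ ^ p)) *
      pow_mul_pow_self_of_sign hb N
  · ring

/-- Terms l < N reflect to a harmonic sum up to N - 1, the term l = N is zero by `0⁻¹ = 0`, and l >
N gives the full series. The last summand of the limit corrects N - 1 to N. -/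
theorem tendsto_sum_shift_sub {b : ℝ} (hb : b = 1 ∨ b = -1) {p : ℕ} (hp : 1 ≤ p)
    (hpb : b = 1 → p ≠ 1) {N : ℕ} (hN : 1 ≤ N) :
    Tendsto (fun L : ℕ => ∑ m ∈ Finset.range L, b ^ (m + 1) * ((m : ℝ) + 1 - N)⁻¹ ^ p) atTop
      (𝓝 (b ^ N * b * (lerchPhi b p 1 + (-1) ^ p * genHarmonic p b N)
        - (-1) ^ p * (N : ℝ)⁻¹ ^ p)) := by
  obtain ⟨M, rfl⟩ := Nat.exists_eq_add_of_le' hN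
  rw [← tendsto_add_atTop_iff_nat (M + 1)]
  have h := ((tendsto_sum_range_lerchPhi_one hb hp hpb).const_mul (b ^ (M + 1))).const_add
    (b ^ (M + 1) * (-1) ^ p * (b * genHarmonic p b M))
  convert h using 2 with L
  · rw [add_comm L, Finset.sum_range_add, Finset.mul_sum]
    congr 1
    · rw [Finset.sum_range_succ, ← sum_range_eq_mul_genHarmonic, Finset.mul_sum,
        ← Finset.sum_range_reflect]
      push_cast
      rw [sub_self, inv_zero, zero_pow (by omega), mul_zero, add_zero]
      refine Finset.sum_congr rfl fun m hm => ?_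
      rw [Finset.mem_range] at hm
      obtain ⟨d, rfl⟩ := Nat.exists_eq_add_of_lt hm
      rw [show m + d + 1 - 1 - m = d by omega]
      push_cast
      rw [show (d : ℝ) + 1 - (m + d + 1 + 1) = -(m + 1) by ring, inv_neg,
        neg_pow ((m : ℝ) + 1)⁻¹]
      linear_combination (-(b ^ (d + 1) * (-1) ^ p * ((m : ℝ) + 1)⁻¹ ^ p)) *
        pow_mul_pow_self_of_sign hb (m + 1)
    · refine Finset.sum_congr rfl fun m _ => ?_
      push_cast
      rw [show (M : ℝ) + 1 + m + 1 - (M + 1) = m + 1 by ring,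
        show M + 1 + m + 1 = (M + 1) + (m + 1) by ring, pow_add b]
      ring
  · rw [genHarmonic_succ]
    push_cast
    linear_combination ((-1) ^ p * ((M : ℝ) + 1)⁻¹ ^ p) * pow_mul_pow_self_of_sign hb (M + 1)

/-- The index l = z must be left out because the partial fraction identity breaks down there. -/
theorem tendsto_sum_omit {b : ℝ} (hb : b = 1 ∨ b = -1) {s : ℕ} (hs : 1 ≤ s)
    (hbs : b = 1 → s ≠ 1) (z : ℤ) :
    Tendsto (fun L : ℕ => ∑ m ∈ Finset.range L,
        if (m : ℤ) + 1 = z then 0 else b ^ (m + 1) * ((m : ℝ) + 1)⁻¹ ^ s) atTop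
      (𝓝 (b * lerchPhi b s 1 - if 0 < z then b ^ z * (z : ℝ)⁻¹ ^ s else 0)) := by
  refine ((tendsto_sum_range_lerchPhi_one hb hs hbs).sub_const _).congr' ?_
  filter_upwards [eventually_ge_atTop z.toNat] with L hL
  rw [sub_eq_iff_eq_add]
  split_ifs with hz
  · obtain ⟨M, rfl⟩ : ∃ M : ℕ, z = M + 1 := ⟨z.toNat - 1, by omega⟩
    have h1 : (b ^ ((M : ℤ) + 1) * ((((M : ℤ) + 1 : ℤ) : ℝ))⁻¹ ^ s)
        = ∑ m ∈ Finset.range L, if M = m then b ^ (m + 1) * ((m : ℝ) + 1)⁻¹ ^ s else 0 := by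
      rw [Finset.sum_ite_eq, if_pos (Finset.mem_range.mpr (by omega))]
      push_cast
      norm_cast
    rw [h1, ← Finset.sum_add_distrib]
    refine Finset.sum_congr rfl fun m _ => ?_
    by_cases hm : M = m
    · simp [hm]
    · rw [if_neg (by omega), if_neg hm, add_zero]
  · rw [add_zero]
    refine Finset.sum_congr rfl fun m _ => ?_
    rw [if_neg (by omega)]

/-! ### Partial fractions summed over l, then over multiples of n -/

/-- Summing the partial fraction decomposition of `1 / (z^q (l - z)^p)` against `b^l`. -/
theorem partialFraction_limit {b : ℝ} (hb : b = 1 ∨ b = -1) {p q : ℕ} (hp : 1 ≤ p) (hq : 1 ≤ q)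
    (hpb : b = 1 → p ≠ 1) {z : ℤ} (hz : z ≠ 0) {β : ℝ}
    (hβ : Tendsto (fun L : ℕ => ∑ m ∈ Finset.range L, b ^ (m + 1) * ((m : ℝ) + 1 - z)⁻¹ ^ p)
      atTop (𝓝 β)) :
    (z : ℝ)⁻¹ ^ q * β
      = ∑ i ∈ Finset.Icc 1 q, ((p + q - i - 1).choose (p - 1) : ℝ) * (z : ℝ)⁻¹ ^ i *
          (b * lerchPhi b (p + q - i) 1
            - if 0 < z then b ^ z * (z : ℝ)⁻¹ ^ (p + q - i) else 0)
      + ∑ i ∈ Finset.Icc 1 p, ((p + q - i - 1).choose (q - 1) : ℝ) *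
          ∑' m : ℕ, b ^ (m + 1) * ((m : ℝ) + 1)⁻¹ ^ (p + q - i) * ((m : ℝ) + 1 - z)⁻¹ ^ i := by
  refine tendsto_nhds_unique (hβ.const_mul _) ?_
  have hlim : Tendsto (fun L : ℕ =>
      ∑ i ∈ Finset.Icc 1 q, ((p + q - i - 1).choose (p - 1) : ℝ) * (z : ℝ)⁻¹ ^ i *
        (∑ m ∈ Finset.range L,
          if (m : ℤ) + 1 = z then 0 else b ^ (m + 1) * ((m : ℝ) + 1)⁻¹ ^ (p + q - i))
      + ∑ i ∈ Finset.Icc 1 p, ((p + q - i - 1).choose (q - 1) : ℝ) * ∑ m ∈ Finset.range L,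
          b ^ (m + 1) * ((m : ℝ) + 1)⁻¹ ^ (p + q - i) * ((m : ℝ) + 1 - z)⁻¹ ^ i) atTop
      (𝓝 (∑ i ∈ Finset.Icc 1 q, ((p + q - i - 1).choose (p - 1) : ℝ) * (z : ℝ)⁻¹ ^ i *
          (b * lerchPhi b (p + q - i) 1
            - if 0 < z then b ^ z * (z : ℝ)⁻¹ ^ (p + q - i) else 0)
      + ∑ i ∈ Finset.Icc 1 p, ((p + q - i - 1).choose (q - 1) : ℝ) *
          ∑' m : ℕ, b ^ (m + 1) * ((m : ℝ) + 1)⁻¹ ^ (p + q - i) * ((m : ℝ) + 1 - z)⁻¹ ^ i)) := by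
    refine Tendsto.add (tendsto_finsetSum _ fun i hi => ?_) (tendsto_finsetSum _ fun i hi => ?_)
    · rw [Finset.mem_Icc] at hi
      refine Tendsto.const_mul _ (tendsto_sum_omit hb (by omega) (fun h => ?_) z)
      have := hpb h
      omega
    · rw [Finset.mem_Icc] at hi
      exact Tendsto.const_mul _
        (summable_inv_pow_mul_inv_sub_pow hb (by omega) hi.1 z).hasSum.tendsto_sum_nat
  refine hlim.congr fun L => ?_
  simp_rw [Finset.mul_sum]
  rw [Finset.sum_comm, Finset.sum_comm (s := Finset.Icc 1 p), ← Finset.sum_add_distrib]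
  refine Finset.sum_congr rfl fun m _ => ?_
  by_cases hmz : (m : ℤ) + 1 = z
  -- At l = z every power of (l-z)⁻¹ is zero, and the remaining terms are removed by the omission.
  · have h0 : (m : ℝ) + 1 - z = 0 := by rw [← hmz]; push_cast; ring
    rw [h0, inv_zero, zero_pow (by omega), mul_zero, mul_zero]
    rw [Finset.sum_eq_zero, Finset.sum_eq_zero, add_zero]
    · intro i hi
      rw [Finset.mem_Icc] at hi
      rw [zero_pow (by omega), mul_zero, mul_zero]
    · intro i _
      rw [if_pos hmz, mul_zero]
  · have hz' : (z : ℝ) ≠ 0 := by exact_mod_cast hz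
    have hy : (m : ℝ) + 1 - z ≠ 0 := by
      intro h
      apply hmz
      have : (m : ℝ) + 1 = z := by linarith
      exact_mod_cast this
    have hl : (m : ℝ) + 1 ≠ 0 := by positivity
    have hXYZ : (z : ℝ)⁻¹ * ((m : ℝ) + 1 - z)⁻¹
        = ((m : ℝ) + 1)⁻¹ * ((z : ℝ)⁻¹ + ((m : ℝ) + 1 - z)⁻¹) := by
      field_simp
      ring
    rw [show (z : ℝ)⁻¹ ^ q * (b ^ (m + 1) * ((m : ℝ) + 1 - z)⁻¹ ^ p)
      = b ^ (m + 1) * ((z : ℝ)⁻¹ ^ q * ((m : ℝ) + 1 - z)⁻¹ ^ p) by ring,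
      partialFraction hXYZ hp hq, mul_add, Finset.mul_sum, Finset.mul_sum]
    congr 1
    · refine Finset.sum_congr rfl fun i _ => ?_
      rw [if_neg hmz]
      ring
    · refine Finset.sum_congr rfl fun i _ => ?_
      ring

/-- The hockey-stick identity. -/
theorem sum_choose_partialFraction {p q : ℕ} (hp : 1 ≤ p) (hq : 1 ≤ q) :
    ∑ i ∈ Finset.Icc 1 p, ((p + q - i - 1).choose (q - 1) : ℝ) = ((p + q - 1).choose q : ℝ) := by
  have h := Nat.sum_Icc_choose (p + q - 2) (q - 1)
  rw [show p + q - 2 + 1 = p + q - 1 by omega, Nat.sub_add_cancel hq] at h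
  rw [← h]
  push_cast
  refine Finset.sum_nbij' (fun i => p + q - i - 1) (fun i => p + q - i - 1) ?_ ?_ ?_ ?_ ?_
  · intro i hi; simp at hi ⊢; omega
  · intro i hi; simp at hi ⊢; omega
  · intro i hi; simp at hi ⊢; omega
  · intro i hi; simp at hi ⊢; omega
  · intro i _; rfl

theorem sum_even_eq (g : ℕ → ℝ) (q : ℕ) :
    ∑ i ∈ Finset.Icc 1 q, (if Even i then g i else 0)
      = ∑ k ∈ Finset.range (q / 2 + 1), g (2 * k) - g 0 := by
  rw [Finset.sum_range_succ', mul_zero, add_sub_cancel_right, ← sum_Icc_one_eq_sum_range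
    (fun k => g (2 * k)), ← Finset.sum_filter]
  refine Finset.sum_nbij' (fun i => i / 2) (fun k => 2 * k) ?_ ?_ ?_ ?_ ?_
  · intro i hi
    simp only [Finset.mem_filter, Finset.mem_Icc, Nat.even_iff] at hi ⊢
    omega
  · intro i hi
    simp only [Finset.mem_filter, Finset.mem_Icc, Nat.even_iff] at hi ⊢
    omega
  · intro i hi
    simp only [Finset.mem_filter, Finset.mem_Icc, Nat.even_iff] at hi ⊢
    omega
  · intro i _
    simp
  · intro i hi
    simp only [Finset.mem_filter, Finset.mem_Icc] at hi
    rw [Nat.mul_div_cancel' hi.2.two_dvd]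

/-- The total of the omitted terms l = nk. Only k > 0 contributes, and (ab^n)^k b^(nk) = a^k. -/
theorem tendsto_sum_diagonal {a b : ℝ} (ha : a = 1 ∨ a = -1) (hb : b = 1 ∨ b = -1)
    {n : ℕ} (hn : 1 ≤ n) {i s : ℕ} (hi : 1 ≤ i) (hs : 1 ≤ s) :
    Tendsto (fun K : ℕ => ∑ k ∈ Finset.Icc (-(K : ℤ)) (K : ℤ), (a * b ^ n) ^ k *
        ((((n : ℤ) * k : ℤ) : ℝ)⁻¹ ^ i * if 0 < (n : ℤ) * k then
          b ^ ((n : ℤ) * k) * (((n : ℤ) * k : ℤ) : ℝ)⁻¹ ^ s else 0)) atTop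
      (𝓝 ((n : ℝ)⁻¹ ^ (i + s) * (a * lerchPhi a (i + s) 1))) := by
  have hn' : (0 : ℤ) < n := by exact_mod_cast hn
  refine ((tendsto_sum_Icc_one ha (s := i + s) (by omega) (by omega)).const_mul _).congr
    fun K => ?_
  rw [sum_Icc_neg_eq, Finset.mul_sum]
  simp only [mul_zero, lt_irrefl, if_false, zero_add]
  refine Finset.sum_congr rfl fun h hh => ?_
  rw [Finset.mem_Icc] at hh
  have hh' : (0 : ℤ) < h := by exact_mod_cast hh.1
  rw [if_pos (by positivity), if_neg (by rw [mul_neg]; have := mul_pos hn' hh'; omega)]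
  push_cast
  rw [mul_zero, mul_zero, add_zero, zpow_natCast, mul_inv, mul_pow, mul_pow, mul_pow,
    ← Nat.cast_mul, zpow_natCast, pow_mul, pow_add, pow_add]
  linear_combination (-((n : ℝ)⁻¹ ^ i * (n : ℝ)⁻¹ ^ s * a ^ h * (h : ℝ)⁻¹ ^ i * (h : ℝ)⁻¹ ^ s)) *
    pow_mul_pow_self_of_sign (b := b ^ n) (by simpa using sign_mul_pow_sign (.inl rfl) hb n) h

theorem tendsto_sum_product_part {a b : ℝ} (ha : a = 1 ∨ a = -1) (hb : b = 1 ∨ b = -1)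
    {n : ℕ} (hn : 1 ≤ n) {p q : ℕ} (hp : 1 ≤ p) :
    Tendsto (fun K : ℕ => ∑ k ∈ Finset.Icc (-(K : ℤ)) (K : ℤ), (a * b ^ n) ^ k *
      ∑ i ∈ Finset.Icc 1 q, ((p + q - i - 1).choose (p - 1) : ℝ) * (((n : ℤ) * k : ℤ) : ℝ)⁻¹ ^ i *
        (b * lerchPhi b (p + q - i) 1 - if 0 < (n : ℤ) * k then
          b ^ ((n : ℤ) * k) * (((n : ℤ) * k : ℤ) : ℝ)⁻¹ ^ (p + q - i) else 0)) atTop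
      (𝓝 (∑ i ∈ Finset.Icc 1 q, ((p + q - i - 1).choose (p - 1) : ℝ) *
        ((n : ℝ)⁻¹ ^ i * (b * lerchPhi b (p + q - i) 1) *
          (if Even i then 2 * (a * b ^ n) * lerchPhi (a * b ^ n) i 1 else 0)
        - (n : ℝ)⁻¹ ^ (p + q) * (a * lerchPhi a (p + q) 1)))) := by
  have hc := sign_mul_pow_sign ha hb n
  simp_rw [Finset.mul_sum]
  simp_rw [Finset.sum_comm (t := Finset.Icc 1 q)]
  refine tendsto_finsetSum _ fun i hi => ?_
  rw [Finset.mem_Icc] at hi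
  have h1 := (tendsto_sum_punctured hc hi.1).const_mul
    ((n : ℝ)⁻¹ ^ i * (b * lerchPhi b (p + q - i) 1))
  have h2 := tendsto_sum_diagonal ha hb hn hi.1 (show 1 ≤ p + q - i by omega)
  rw [show i + (p + q - i) = p + q by omega] at h2
  refine ((h1.sub h2).const_mul _).congr fun K => ?_
  rw [Finset.mul_sum, ← Finset.sum_sub_distrib, Finset.mul_sum]
  refine Finset.sum_congr rfl fun k _ => ?_
  push_cast
  rw [mul_inv, mul_pow]
  ring

theorem tendsto_sum_bilateral_part {a b : ℝ} (ha : a = 1 ∨ a = -1) (hb : b = 1 ∨ b = -1)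
    {n : ℕ} (hn : 1 ≤ n) {p q : ℕ} (hp : 1 ≤ p) (hq : 1 ≤ q) (hpq : Odd (p + q))
    (hqa : a = 1 → q ≠ 1) :
    Tendsto (fun K : ℕ => ∑ k ∈ Finset.Icc (-(K : ℤ)) (K : ℤ), (a * b ^ n) ^ k *
      ∑ i ∈ Finset.Icc 1 p, ((p + q - i - 1).choose (q - 1) : ℝ) *
        ∑' m : ℕ, b ^ (m + 1) * ((m : ℝ) + 1)⁻¹ ^ (p + q - i) *
          ((m : ℝ) + 1 - ((n : ℤ) * k : ℤ))⁻¹ ^ i) atTop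
      (𝓝 (∑ i ∈ Finset.Icc 1 p, ((p + q - i - 1).choose (q - 1) : ℝ) *
        ((n : ℝ)⁻¹ ^ (p + q) * (∑ r ∈ Finset.Ico 1 n,
          b ^ r * (lerchPhi a (p + q - i) ((r : ℝ) / n) * lerchTheta (a * b ^ n) i r n)
        + b ^ n * (lerchPhi a (p + q - i) 1 *
          if Even i then 2 * lerchPhi (a * b ^ n) i 1 else 0))))) := by
  simp_rw [Finset.mul_sum (s := Finset.Icc 1 p)]
  simp_rw [Finset.sum_comm (t := Finset.Icc 1 p)]
  refine tendsto_finsetSum _ fun i hi => ?_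
  rw [Finset.mem_Icc] at hi
  have h := tendsto_sum_zpow_mul_tsum ha hb hn (s := p + q - i) (by omega) hi.1 ?_
  · rw [show p + q - i + i = p + q by omega] at h
    refine (h.const_mul _).congr fun K => ?_
    rw [Finset.mul_sum]
    refine Finset.sum_congr rfl fun k _ => ?_
    push_cast
    ring
  -- The exponent p + q - i equals 1 only for q = 1 and i = p. Then a = -1, and parity excludes p =
  -- 1.
  · intro h1
    have hq1 : q = 1 := by omega
    refine ⟨ha.resolve_left fun h => hqa h hq1, ?_⟩
    have hp1 : p ≠ 1 := by
      rintro rfl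
      subst hq1
      exact absurd hpq (by decide)
    omega

/-! ### Extracting the harmonic sum -/

/-- The two terms with indices `h` and `-h`, in terms of harmonic numbers. -/
theorem pair_eq_genHarmonic {a b : ℝ} (hb : b = 1 ∨ b = -1) {p q : ℕ} (hpq : Odd (p + q))
    (n h : ℕ) (Φ H : ℝ) :
    (a * b ^ n) ^ h * (((n : ℝ) * h)⁻¹ ^ q *
        (b ^ (n * h) * b * (Φ + (-1) ^ p * H) - (-1) ^ p * ((n : ℝ) * h)⁻¹ ^ p))
      + (a * b ^ n) ^ h * ((-((n : ℝ) * h))⁻¹ ^ q * (b ^ (n * h) * b * (Φ - H)))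
    = (n : ℝ)⁻¹ ^ q * b * ((1 - (-1) ^ p) * Φ) * (a ^ h * (h : ℝ)⁻¹ ^ q)
      + (n : ℝ)⁻¹ ^ q * (2 * b * (-1) ^ p) * (a ^ h * H * (h : ℝ)⁻¹ ^ q)
      - (-1) ^ p * (n : ℝ)⁻¹ ^ (p + q) * ((a * b ^ n) ^ h * (h : ℝ)⁻¹ ^ (p + q)) := by
  have hs : (-1 : ℝ) ^ q = -(-1) ^ p := by
    have h1 := hpq.neg_one_pow (α := ℝ)
    rw [pow_add] at h1
    linear_combination (-1 : ℝ) ^ p * h1 - (-1 : ℝ) ^ q * pow_mul_pow_self_of_sign (.inr rfl) p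
  rw [inv_neg, neg_pow ((n : ℝ) * h)⁻¹, hs, mul_inv, mul_pow, mul_pow, mul_pow, pow_mul, pow_add,
    pow_add]
  linear_combination (a ^ h * (n : ℝ)⁻¹ ^ q * (h : ℝ)⁻¹ ^ q * b *
    ((Φ + (-1) ^ p * H) - (-1) ^ p * (Φ - H))) *
    pow_mul_pow_self_of_sign (b := b ^ n) (by simpa using sign_mul_pow_sign (.inl rfl) hb n) h

/-- The harmonic sum converges to the value determined by the partial fraction decomposition. -/
theorem tendsto_harmonic_sum {a b : ℝ} (ha : a = 1 ∨ a = -1) (hb : b = 1 ∨ b = -1)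
    {p q n : ℕ} (hp : 1 ≤ p) (hq : 1 ≤ q) (hn : 1 ≤ n) (hpq : Odd (p + q))
    (hpb : b = 1 → p ≠ 1) (hqa : a = 1 → q ≠ 1) {T₁ T₂ : ℝ}
    (hT₁ : T₁ = ∑ i ∈ Finset.Icc 1 q, ((p + q - i - 1).choose (p - 1) : ℝ) *
        ((n : ℝ)⁻¹ ^ i * (b * lerchPhi b (p + q - i) 1) *
          (if Even i then 2 * (a * b ^ n) * lerchPhi (a * b ^ n) i 1 else 0)
        - (n : ℝ)⁻¹ ^ (p + q) * (a * lerchPhi a (p + q) 1)))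
    (hT₂ : T₂ = ∑ i ∈ Finset.Icc 1 p, ((p + q - i - 1).choose (q - 1) : ℝ) *
        ((n : ℝ)⁻¹ ^ (p + q) * (∑ r ∈ Finset.Ico 1 n,
          b ^ r * (lerchPhi a (p + q - i) ((r : ℝ) / n) * lerchTheta (a * b ^ n) i r n)
        + b ^ n * (lerchPhi a (p + q - i) 1 *
          if Even i then 2 * lerchPhi (a * b ^ n) i 1 else 0)))) :
    Tendsto
      (fun N : ℕ => ∑ k ∈ Finset.Icc 1 N, a ^ k * genHarmonic p b (n * k) / (k : ℝ) ^ q)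
      atTop
      (𝓝 (1 / 2 * (-1) ^ p * b * (n : ℝ) ^ q *
          (T₁ + T₂ - (p + q - 1).choose q * (b * lerchPhi b (p + q) 1))
        + 1 / 2 * (1 - (-1) ^ p) * lerchPhi b p 1 * (a * lerchPhi a q 1)
        + 1 / 2 * b * (n : ℝ)⁻¹ ^ p * (a * b ^ n * lerchPhi (a * b ^ n) (p + q) 1))) := by
  have hc := sign_mul_pow_sign ha hb n
  have hn0 : (n : ℝ) ≠ 0 := by positivity
  have hnz : (0 : ℤ) < n := by exact_mod_cast hn
  -- The weighted right side of the expansion at z = nk. It is also defined at k = 0, where the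
  -- expansion does not hold, so R 0 is subtracted later.
  set R : ℤ → ℝ := fun k =>
    (a * b ^ n) ^ k * (∑ i ∈ Finset.Icc 1 q,
      ((p + q - i - 1).choose (p - 1) : ℝ) * (((n : ℤ) * k : ℤ) : ℝ)⁻¹ ^ i *
        (b * lerchPhi b (p + q - i) 1 - if 0 < (n : ℤ) * k then
          b ^ ((n : ℤ) * k) * (((n : ℤ) * k : ℤ) : ℝ)⁻¹ ^ (p + q - i) else 0))
    + (a * b ^ n) ^ k * ∑ i ∈ Finset.Icc 1 p, ((p + q - i - 1).choose (q - 1) : ℝ) *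
        ∑' m : ℕ, b ^ (m + 1) * ((m : ℝ) + 1)⁻¹ ^ (p + q - i) *
          ((m : ℝ) + 1 - ((n : ℤ) * k : ℤ))⁻¹ ^ i with hR
  have hRlim : Tendsto (fun K : ℕ => ∑ k ∈ Finset.Icc (-(K : ℤ)) (K : ℤ), R k) atTop
      (𝓝 (T₁ + T₂)) := by
    simp only [hR, Finset.sum_add_distrib]
    rw [hT₁, hT₂]
    exact (tendsto_sum_product_part ha hb hn hp).add
      (tendsto_sum_bilateral_part ha hb hn hp hq hpq hqa)
  -- At z = 0 the first family vanishes and every series of the second collapses to the same one of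
  -- weight p + q.
  have hR0 : R 0 = (p + q - 1).choose q * (b * lerchPhi b (p + q) 1) := by
    have hpq2 : 2 ≤ p + q := by omega
    have h1 : ∀ i ∈ Finset.Icc 1 p, ((p + q - i - 1).choose (q - 1) : ℝ) *
        ∑' m : ℕ, b ^ (m + 1) * ((m : ℝ) + 1)⁻¹ ^ (p + q - i) * ((m : ℝ) + 1 - (0 : ℤ))⁻¹ ^ i
        = ((p + q - i - 1).choose (q - 1) : ℝ) * (b * lerchPhi b (p + q) 1) := by
      intro i hi
      rw [Finset.mem_Icc] at hi
      rw [← ((hasSum_lerchPhi hb hpq2 one_pos).mul_left b).tsum_eq]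
      congr 1
      refine tsum_congr fun m => ?_
      rw [Int.cast_zero, sub_zero, mul_assoc, ← pow_add, Nat.sub_add_cancel (by omega)]
      ring
    simp only [hR, mul_zero, zpow_zero, one_mul]
    rw [Finset.sum_congr rfl h1, ← Finset.sum_mul, sum_choose_partialFraction hp hq,
      Finset.sum_eq_zero, zero_add]
    intro i hi
    rw [Finset.mem_Icc] at hi
    rw [Int.cast_zero, inv_zero, zero_pow (by omega), mul_zero, zero_mul]
  have hpair : ∀ h : ℕ, 1 ≤ h → R h + R (-h)
      = (n : ℝ)⁻¹ ^ q * b * ((1 - (-1) ^ p) * lerchPhi b p 1) * (a ^ h * (h : ℝ)⁻¹ ^ q)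
      + (n : ℝ)⁻¹ ^ q * (2 * b * (-1) ^ p) *
          (a ^ h * genHarmonic p b (n * h) * (h : ℝ)⁻¹ ^ q)
      - (-1) ^ p * (n : ℝ)⁻¹ ^ (p + q) * ((a * b ^ n) ^ h * (h : ℝ)⁻¹ ^ (p + q)) := by
    intro h hh
    have hhz : (0 : ℤ) < h := by exact_mod_cast hh
    have hnh : (n : ℤ) * h ≠ 0 := (mul_pos hnz hhz).ne'
    have hp1 := tendsto_sum_shift_sub hb hp hpb (N := n * h) (Nat.mul_pos hn hh)
    have hp2 := tendsto_sum_shift_add hb hp hpb (n * h)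
    have e1 := partialFraction_limit hb hp hq hpb hnh
      (hp1.congr fun L => Finset.sum_congr rfl fun m _ => by push_cast; rfl)
    have e2 := partialFraction_limit hb hp hq hpb (z := (n : ℤ) * (-h)) (by simpa using hnh)
      (hp2.congr fun L => Finset.sum_congr rfl fun m _ => by
        push_cast; rw [mul_neg, sub_neg_eq_add])
    rw [← pair_eq_genHarmonic hb hpq]
    simp only [hR]
    rw [← mul_add, ← mul_add, ← e1, ← e2, zpow_neg_of_sign hc, zpow_natCast]
    push_cast
    rw [mul_neg]
  have hA := tendsto_sum_Icc_one ha hq hqa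
  have hC := tendsto_sum_Icc_one hc (s := p + q) (by omega) (by omega)
  -- The multipliers come from solving `hpair` for the harmonic term, whose coefficient 2b(-1)^p
  -- n^(-q) has inverse (1/2)(-1)^p b n^q.
  have hfin := ((((hRlim.sub_const (R 0)).const_mul (1 / 2 * (-1) ^ p * b * (n : ℝ) ^ q)).add
    (hA.const_mul (1 / 2 * (1 - (-1) ^ p) * lerchPhi b p 1))).add
    (hC.const_mul (1 / 2 * b * (n : ℝ)⁻¹ ^ p)))
  rw [hR0] at hfin
  refine hfin.congr fun K => ?_
  rw [← hR0, sum_Icc_neg_eq, add_sub_cancel_left, Finset.mul_sum, Finset.mul_sum, Finset.mul_sum,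
    ← Finset.sum_add_distrib, ← Finset.sum_add_distrib]
  refine Finset.sum_congr rfl fun h hh => ?_
  rw [hpair h (Finset.mem_Icc.mp hh).1,
    div_eq_mul_inv (a ^ h * genHarmonic p b (n * h)), ← inv_pow (h : ℝ),
    pow_add (n : ℝ)⁻¹]
  have h1 := pow_mul_pow_self_of_sign (b := (-1 : ℝ)) (.inr rfl) p
  have h2 := mul_self_of_sign hb
  have h3 : (n : ℝ) ^ q * (n : ℝ)⁻¹ ^ q = 1 := by
    rw [← mul_pow, mul_inv_cancel₀ hn0, one_pow]
  generalize (-1 : ℝ) ^ p = e at *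
  generalize (n : ℝ) ^ q = x at *
  generalize (n : ℝ)⁻¹ ^ q = y at *
  generalize (n : ℝ)⁻¹ ^ p = P
  generalize (a * b ^ n) ^ h * (h : ℝ)⁻¹ ^ (p + q) = W
  generalize lerchPhi b p 1 = Φ
  linear_combination
    ((1 / 2 * e * (1 - e) * Φ * (a ^ h * (h : ℝ)⁻¹ ^ q)
      + e ^ 2 * (a ^ h * genHarmonic p b (n * h) * (h : ℝ)⁻¹ ^ q)) * (x * y)) * h2
    + (1 / 2 * e * (1 - e) * Φ * (a ^ h * (h : ℝ)⁻¹ ^ q)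
      + e ^ 2 * (a ^ h * genHarmonic p b (n * h) * (h : ℝ)⁻¹ ^ q)
      - 1 / 2 * e ^ 2 * b * P * W) * h3
    + (-(1 / 2) * Φ * (a ^ h * (h : ℝ)⁻¹ ^ q)
      + a ^ h * genHarmonic p b (n * h) * (h : ℝ)⁻¹ ^ q - 1 / 2 * b * P * W) * h1

/-! ### Rearrangement into the closed form -/

/-- The k = 0 defect is exactly the missing index-0 term, since 2bc Φ(c,0,1) = -b for c = ab^n. -/
theorem sum_product_part_eq {a b : ℝ} (ha : a = 1 ∨ a = -1) (hb : b = 1 ∨ b = -1)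
    {p q n : ℕ} (hp : 1 ≤ p) (hq : 1 ≤ q) :
    ∑ i ∈ Finset.Icc 1 q, ((p + q - i - 1).choose (p - 1) : ℝ) *
        ((n : ℝ)⁻¹ ^ i * (b * lerchPhi b (p + q - i) 1) *
          (if Even i then 2 * (a * b ^ n) * lerchPhi (a * b ^ n) i 1 else 0)
        - (n : ℝ)⁻¹ ^ (p + q) * (a * lerchPhi a (p + q) 1))
      - (p + q - 1).choose q * (b * lerchPhi b (p + q) 1)
    = 2 * b * (a * b ^ n) * ∑ k ∈ Finset.range (q / 2 + 1),
        ((p + q - 2 * k - 1).choose (p - 1) : ℝ) * (n : ℝ) ^ (-(2 * (k : ℤ))) *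
          lerchPhi (a * b ^ n) (2 * k) 1 * lerchPhi b (p + q - 2 * k) 1
      - (p + q - 1).choose p * ((n : ℝ)⁻¹ ^ (p + q) * (a * lerchPhi a (p + q) 1)) := by
  have hc := sign_mul_pow_sign ha hb n
  set g : ℕ → ℝ := fun i => ((p + q - i - 1).choose (p - 1) : ℝ) * (n : ℝ)⁻¹ ^ i *
    lerchPhi (a * b ^ n) i 1 * lerchPhi b (p + q - i) 1 with hg
  have h1 : ∀ i ∈ Finset.Icc 1 q, ((p + q - i - 1).choose (p - 1) : ℝ) *
        ((n : ℝ)⁻¹ ^ i * (b * lerchPhi b (p + q - i) 1) *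
          (if Even i then 2 * (a * b ^ n) * lerchPhi (a * b ^ n) i 1 else 0)
        - (n : ℝ)⁻¹ ^ (p + q) * (a * lerchPhi a (p + q) 1))
      = 2 * b * (a * b ^ n) * (if Even i then g i else 0)
        - ((p + q - i - 1).choose (p - 1) : ℝ) *
          ((n : ℝ)⁻¹ ^ (p + q) * (a * lerchPhi a (p + q) 1)) := by
    intro i _
    split_ifs
    · simp only [hg]
      ring
    · ring
  have h2 : ∀ k ∈ Finset.range (q / 2 + 1),
      ((p + q - 2 * k - 1).choose (p - 1) : ℝ) * (n : ℝ) ^ (-(2 * (k : ℤ))) *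
          lerchPhi (a * b ^ n) (2 * k) 1 * lerchPhi b (p + q - 2 * k) 1 = g (2 * k) := by
    intro k _
    simp only [hg]
    rw [zpow_neg, inv_pow]
    norm_cast
  have h3 := sum_choose_partialFraction hq hp
  rw [add_comm q p] at h3
  rw [Finset.sum_congr rfl h1, Finset.sum_congr rfl h2, Finset.sum_sub_distrib, ← Finset.mul_sum,
    ← Finset.sum_mul, sum_even_eq, h3]
  have hg0 : g 0 = ((p + q - 1).choose q : ℝ) * (-(a * b ^ n) / 2) * lerchPhi b (p + q) 1 := by
    simp only [hg, pow_zero, mul_one, Nat.sub_zero, lerchPhi_zero_one hc]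
    rw [show (p + q - 1).choose (p - 1) = (p + q - 1).choose q from
      Nat.choose_symm_of_eq_add (by omega)]
  rw [hg0]
  linear_combination ((p + q - 1).choose q : ℝ) * b * lerchPhi b (p + q) 1 * mul_self_of_sign hc

/-- The diagonal terms left over from the product part supply the index-0 term here, since 2b^n
Φ(ab^n,0,1) = -a. -/
theorem sum_bilateral_part_eq {a b : ℝ} (ha : a = 1 ∨ a = -1) (hb : b = 1 ∨ b = -1)
    {p q n : ℕ} (hp : 1 ≤ p) (hq : 1 ≤ q) (hn : 1 ≤ n) :
    ∑ i ∈ Finset.Icc 1 p, ((p + q - i - 1).choose (q - 1) : ℝ) *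
        ((n : ℝ)⁻¹ ^ (p + q) * (∑ r ∈ Finset.Ico 1 n,
          b ^ r * (lerchPhi a (p + q - i) ((r : ℝ) / n) * lerchTheta (a * b ^ n) i r n)
        + b ^ n * (lerchPhi a (p + q - i) 1 *
          if Even i then 2 * lerchPhi (a * b ^ n) i 1 else 0)))
      - (p + q - 1).choose p * ((n : ℝ)⁻¹ ^ (p + q) * (a * lerchPhi a (p + q) 1))
    = (n : ℝ)⁻¹ ^ (p + q) * (2 * b ^ n * ∑ j ∈ Finset.range (p / 2 + 1),
        ((p + q - 2 * j - 1).choose (q - 1) : ℝ) *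
          lerchPhi (a * b ^ n) (2 * j) 1 * lerchPhi a (p + q - 2 * j) 1
      + a * b * ∑ j ∈ Finset.Icc 2 n, ∑ k ∈ Finset.Icc 1 p,
          ((p + q - k - 1).choose (q - 1) : ℝ) * b ^ j * (-1) ^ k *
            lerchTheta (a * b ^ n) k ((j : ℝ) - 1) (n : ℝ) *
            lerchPhi a (p + q - k) (((n : ℝ) - (j : ℝ) + 1) / (n : ℝ))) := by
  have hc := sign_mul_pow_sign ha hb n
  have hn0 : (n : ℝ) ≠ 0 := by positivity
  set g : ℕ → ℝ := fun i => ((p + q - i - 1).choose (q - 1) : ℝ) *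
    lerchPhi (a * b ^ n) i 1 * lerchPhi a (p + q - i) 1 with hg
  set t : ℕ → ℕ → ℝ := fun i r => ((p + q - i - 1).choose (q - 1) : ℝ) *
    (b ^ r * (lerchPhi a (p + q - i) ((r : ℝ) / n) * lerchTheta (a * b ^ n) i r n)) with ht
  have h1 : ∀ i ∈ Finset.Icc 1 p, ((p + q - i - 1).choose (q - 1) : ℝ) *
        ((n : ℝ)⁻¹ ^ (p + q) * (∑ r ∈ Finset.Ico 1 n,
          b ^ r * (lerchPhi a (p + q - i) ((r : ℝ) / n) * lerchTheta (a * b ^ n) i r n)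
        + b ^ n * (lerchPhi a (p + q - i) 1 *
          if Even i then 2 * lerchPhi (a * b ^ n) i 1 else 0)))
      = (n : ℝ)⁻¹ ^ (p + q) * (2 * b ^ n) * (if Even i then g i else 0)
        + (n : ℝ)⁻¹ ^ (p + q) * ∑ r ∈ Finset.Ico 1 n, t i r := by
    intro i _
    simp only [ht]
    rw [← Finset.mul_sum]
    split_ifs
    · simp only [hg]
      ring
    · ring
  have h2 : ∑ j ∈ Finset.Icc 2 n, ∑ k ∈ Finset.Icc 1 p,
          ((p + q - k - 1).choose (q - 1) : ℝ) * b ^ j * (-1) ^ k *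
            lerchTheta (a * b ^ n) k ((j : ℝ) - 1) (n : ℝ) *
            lerchPhi a (p + q - k) (((n : ℝ) - (j : ℝ) + 1) / (n : ℝ))
      = a * b * ∑ i ∈ Finset.Icc 1 p, ∑ r ∈ Finset.Ico 1 n, t i r := by
    rw [Finset.sum_comm (s := Finset.Icc 1 p), Finset.mul_sum]
    refine Finset.sum_nbij' (fun j => n + 1 - j) (fun r => n + 1 - r) ?_ ?_ ?_ ?_ ?_
    · intro j hj; simp at hj ⊢; omega
    · intro j hj; simp at hj ⊢; omega
    · intro j hj; simp at hj ⊢; omega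
    · intro j hj; simp at hj ⊢; omega
    · intro j hj
      rw [Finset.mem_Icc] at hj
      obtain ⟨r, hr⟩ : ∃ r, n + 1 = j + r := ⟨n + 1 - j, by omega⟩
      have hr' : (n : ℝ) + 1 = j + r := by exact_mod_cast hr
      have hbn : b ^ n = b * b ^ j * b ^ r := by
        have h := congrArg (fun e => b * b ^ e) hr
        simp only [pow_add, pow_one] at h
        linear_combination h - b ^ n * mul_self_of_sign hb
      rw [show n + 1 - j = r by omega, Finset.mul_sum]
      refine Finset.sum_congr rfl fun k _ => ?_
      rw [show (n : ℝ) - j + 1 = r by linarith, show (j : ℝ) - 1 = n - r by linarith,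
        lerchTheta_reflect hc k hn0]
      simp only [ht]
      generalize lerchTheta (a * b ^ n) k r n = Θ
      generalize lerchPhi a (p + q - k) ((r : ℝ) / n) = Φ
      rw [hbn]
      linear_combination (((p + q - k - 1).choose (q - 1) : ℝ) * Θ * Φ * a * b * b ^ r) *
        ((-1) ^ k * (-1) ^ k * pow_mul_pow_self_of_sign hb j
          + pow_mul_pow_self_of_sign (b := (-1 : ℝ)) (.inr rfl) k)
  have hab : a * b * (a * b) = 1 := by
    linear_combination b * b * mul_self_of_sign ha + mul_self_of_sign hb
  rw [h2, Finset.sum_congr rfl h1, Finset.sum_add_distrib, ← Finset.mul_sum, ← Finset.mul_sum,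
    sum_even_eq]
  have hg0 : g 0 = ((p + q - 1).choose p : ℝ) * (-(a * b ^ n) / 2) * lerchPhi a (p + q) 1 := by
    simp only [hg, Nat.sub_zero, lerchPhi_zero_one hc]
    rw [show (p + q - 1).choose (q - 1) = (p + q - 1).choose p from
      Nat.choose_symm_of_eq_add (by omega)]
  rw [hg0]
  linear_combination (n : ℝ)⁻¹ ^ (p + q) * (((p + q - 1).choose p : ℝ) * a *
      lerchPhi a (p + q) 1 * pow_mul_pow_self_of_sign hb n
    - (∑ i ∈ Finset.Icc 1 p, ∑ r ∈ Finset.Ico 1 n, t i r) * hab)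

theorem theorem5 (p q n : ℕ) (hp : 1 ≤ p) (hq : 1 ≤ q) (hn : 1 ≤ n) (hpq : Odd (p + q))
    (a b : ℝ) (ha : a = 1 ∨ a = -1) (hb : b = 1 ∨ b = -1)
    (hpb : b = 1 → p ≠ 1) (hqa : a = 1 → q ≠ 1) :
    Tendsto
      (fun N : ℕ => ∑ k ∈ Finset.Icc 1 N, a ^ k * genHarmonic p b (n * k) / (k : ℝ) ^ q)
      atTop
      (𝓝 (1 / 2 * a * b ^ (n - 1) * (n : ℝ) ^ (-(p : ℤ)) * lerchPhi (a * b ^ n) (p + q) 1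
        + 1 / 2 * a * (1 - (-1) ^ p) * lerchPhi a q 1 * lerchPhi b p 1
        - a * b ^ n * (-(n : ℝ)) ^ q *
            ∑ k ∈ Finset.range (q / 2 + 1),
              ((p + q - 2 * k - 1).choose (p - 1) : ℝ) * (n : ℝ) ^ (-(2 * (k : ℤ))) *
                lerchPhi (a * b ^ n) (2 * k) 1 * lerchPhi b (p + q - 2 * k) 1
        + b ^ (n - 1) * (-(n : ℝ)) ^ (-(p : ℤ)) *
            ∑ j ∈ Finset.range (p / 2 + 1),
              ((p + q - 2 * j - 1).choose (q - 1) : ℝ) *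
                lerchPhi (a * b ^ n) (2 * j) 1 * lerchPhi a (p + q - 2 * j) 1
        + a / 2 * (-(n : ℝ)) ^ (-(p : ℤ)) *
            ∑ j ∈ Finset.Icc 2 n, ∑ k ∈ Finset.Icc 1 p,
              ((p + q - k - 1).choose (q - 1) : ℝ) * b ^ j * (-1) ^ k *
                lerchTheta (a * b ^ n) k ((j : ℝ) - 1) (n : ℝ) *
                lerchPhi a (p + q - k) (((n : ℝ) - (j : ℝ) + 1) / (n : ℝ)))) := by

  have hn0 : (n : ℝ) ≠ 0 := by positivity
  have h := tendsto_harmonic_sum ha hb hp hq hn hpq hpb hqa rfl rfl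
  convert h using 2
  -- The diagonal multiple of Φ(a,p+q,1) enters the two identities with opposite signs and cancels.
  rw [sub_eq_iff_eq_add.mp (sum_product_part_eq ha hb (n := n) hp hq),
    sub_eq_iff_eq_add.mp (sum_bilateral_part_eq ha hb hp hq hn)]
  have hs : (-1 : ℝ) ^ q = -(-1) ^ p := by
    have h1 := hpq.neg_one_pow (α := ℝ)
    rw [pow_add] at h1
    linear_combination (-1 : ℝ) ^ p * h1 - (-1 : ℝ) ^ q * pow_mul_pow_self_of_sign (.inr rfl) p
  have hz1 : (n : ℝ) ^ (-(p : ℤ)) = (n : ℝ)⁻¹ ^ p := by rw [zpow_neg, inv_pow, zpow_natCast]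
  have hz2 : (-(n : ℝ)) ^ (-(p : ℤ)) = (-1) ^ p * (n : ℝ)⁻¹ ^ p := by
    rw [zpow_neg, zpow_natCast, ← inv_pow, inv_neg, neg_pow]
  have hnq : (n : ℝ) ^ q * (n : ℝ)⁻¹ ^ q = 1 := by
    rw [← mul_pow, mul_inv_cancel₀ hn0, one_pow]
  have hbn : b ^ n = b ^ (n - 1) * b := by rw [← pow_succ, Nat.sub_add_cancel hn]
  have hb2 := mul_self_of_sign hb
  rw [hz1, hz2, neg_pow (n : ℝ) q, hs, pow_add (n : ℝ)⁻¹]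
  set S₁ := ∑ k ∈ Finset.range (q / 2 + 1),
    ((p + q - 2 * k - 1).choose (p - 1) : ℝ) * (n : ℝ) ^ (-(2 * (k : ℤ))) *
      lerchPhi (a * b ^ n) (2 * k) 1 * lerchPhi b (p + q - 2 * k) 1
  set S₂ := ∑ j ∈ Finset.range (p / 2 + 1), ((p + q - 2 * j - 1).choose (q - 1) : ℝ) *
    lerchPhi (a * b ^ n) (2 * j) 1 * lerchPhi a (p + q - 2 * j) 1
  set S₃ := ∑ j ∈ Finset.Icc 2 n, ∑ k ∈ Finset.Icc 1 p,
    ((p + q - k - 1).choose (q - 1) : ℝ) * b ^ j * (-1) ^ k *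
      lerchTheta (a * b ^ n) k ((j : ℝ) - 1) (n : ℝ) *
      lerchPhi a (p + q - k) (((n : ℝ) - (j : ℝ) + 1) / (n : ℝ))
  generalize lerchPhi (a * b ^ n) (p + q) 1 = Ψ
  generalize (-1 : ℝ) ^ p = e
  generalize (n : ℝ)⁻¹ ^ p = P at *
  generalize (n : ℝ)⁻¹ ^ q = y at *
  generalize (n : ℝ) ^ q = x at *
  clear_value S₁ S₂ S₃
  rw [hbn]
  generalize b ^ (n - 1) = B
  linear_combination
    (-(1 / 2) * a * B * P * Ψ - e * a * B * b * x * S₁ - e * B * P * S₂ * x * y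
      - 1 / 2 * e * a * P * S₃ * x * y) * hb2
    - (e * B * P * S₂ + 1 / 2 * e * a * P * S₃) * hnq
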